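/- Let $X$ and $Y$ be Hilbert $C^*$-modules over a $C^*$-algebra $A$. Let $D : \mathscr{D}(D) \to Y$ be an unbounded selfadjoint and regular operator on $Y$, let $\Gamma : Y \to Y$ be a bounded adjointable positive operator with dense image, and let $\Phi : X \to Y$ be a bounded adjointable operator whose adjoint $\Phi^* : Y \to X$ has dense image. Put $G := \Phi\Phi^* : Y \to Y$ and suppose that (1) $G\Gamma(\mathscr{D}(D)) \subseteq \mathscr{D}(D)$; (2) the twisted commutator $D G \Gamma - \Gamma G D : \mathscr{D}(D) \to Y$ extends to a bounded operator $d_\Gamma(G) : Y \to Y$; (3) the image of $d_\Gamma(G)$ is contained in the image of $\Gamma^{1/2}$, and the operator $\Gamma^{-1/2} d_\Gamma(G) \Gamma^{-1/2} : \operatorname{Im}(\Gamma^{1/2}) \to Y$ extends to a bounded operator $\rho_\Gamma(G) : Y \to Y$. Consider the operator $\Phi^* D \Phi$ on $X$ with domain $\{x \in X : \Phi(x) \in \mathscr{D}(D)\}$. Then $\Phi^* D\Phi$ is closable, and its closure, the modular lift $D_\Delta := \overline{\Phi^* D \Phi}$, is selfadjoint and regular. Here adjoints are taken with respect to the $A$-valued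 inner products, selfadjoint means densely defined and equal to the adjoint, and an $A$-linear operator $T$ is regular if it is closed and densely defined, its adjoint $T^*$ is densely defined, and $1 + T^*T$ has dense image. -/

import Mathlib

/-!
Bounded adjointable operators and unbounded operators on Hilbert C*-modules.

A Hilbert C*-module over a C*-algebra `A` is a complete space with Mathlib's `CStarModule A`:
the `A`-valued inner product is conjugate linear in the first and linear in the second variable.
Mathlib writes the action of `A` on the left, with `⟪x, a • y⟫ = a * ⟪x, y⟫`; a right Hilbert module
over a C*-algebra `B` is such a module over the opposite C*-algebra `A = Bᵐᵒᵖ`.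
-/

set_option linter.unusedSectionVars false

namespace HilbertCStar

noncomputable section

variable (A : Type*) [NonUnitalCStarAlgebra A] [PartialOrder A] [StarOrderedRing A]
variable {X : Type*} [NormedAddCommGroup X] [NormedSpace ℂ X] [SMul A X] [CStarModule A X]
variable {Y : Type*} [NormedAddCommGroup Y] [NormedSpace ℂ Y] [SMul A Y] [CStarModule A Y]

/-- `S` is the adjoint of the bounded operator `T`: `⟪T x, y⟫ = ⟪x, S y⟫` for all `x`, `y`. -/
def IsAdjointPair (T : X →L[ℂ] Y) (S : Y →L[ℂ] X) : Prop :=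
  ∀ x y, inner A (T x) y = inner A x (S y)

/-! ### The C*-algebra of bounded adjointable operators -/

theorem ext_inner {u v : X} (h : ∀ x : X, inner A x u = inner A x v) : u = v := by
  have h0 : inner A (u - v) (u - v) = 0 := by
    rw [CStarModule.inner_sub_right, h, sub_self]
  exact sub_eq_zero.1 (CStarModule.inner_self.1 h0)

theorem IsAdjointPair.unique {T : X →L[ℂ] Y} {S S' : Y →L[ℂ] X}
    (h : IsAdjointPair A T S) (h' : IsAdjointPair A T S') : S = S' := by
  ext y
  exact ext_inner A fun x => by rw [← h, ← h']

theorem IsAdjointPair.symm {T : X →L[ℂ] Y} {S : Y →L[ℂ] X}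
    (h : IsAdjointPair A T S) : IsAdjointPair A S T := fun y x => by
  rw [← CStarModule.star_inner, ← h, CStarModule.star_inner]

variable (X) in
/-- The subalgebra of bounded adjointable operators among all bounded operators. -/
def adjointableSubalgebra : Subalgebra ℂ (X →L[ℂ] X) where
  carrier := {T | ∃ S : X →L[ℂ] X, IsAdjointPair A T S}
  mul_mem' := by
    rintro T T' ⟨S, hS⟩ ⟨S', hS'⟩
    exact ⟨S' * S, fun x y => by simp [hS _ _, hS' _ _]⟩
  add_mem' := by
    rintro T T' ⟨S, hS⟩ ⟨S', hS'⟩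
    exact ⟨S + S', fun x y => by simp [hS _ _, hS' _ _]⟩
  algebraMap_mem' := by
    intro z
    refine ⟨algebraMap ℂ _ (star z), fun x y => ?_⟩
    simp [Algebra.algebraMap_eq_smul_one]

variable (X) in
/-- The bounded adjointable operators on the Hilbert C*-module `X`, with the operator norm. -/
def AdjointableOp : Type _ := adjointableSubalgebra A X

namespace AdjointableOp

instance : NormedRing (AdjointableOp A X) := inferInstanceAs (NormedRing (adjointableSubalgebra A X))

instance : NormedAlgebra ℂ (AdjointableOp A X) :=
  inferInstanceAs (NormedAlgebra ℂ (adjointableSubalgebra A X))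

variable {A}

/-- The underlying bounded operator. -/
def toCLM (T : AdjointableOp A X) : X →L[ℂ] X := T.1

theorem toCLM_injective : Function.Injective (toCLM : AdjointableOp A X → X →L[ℂ] X) :=
  Subtype.val_injective

theorem toCLM_mul (S T : AdjointableOp A X) : (S * T).toCLM = S.toCLM * T.toCLM := rfl

theorem toCLM_add (S T : AdjointableOp A X) : (S + T).toCLM = S.toCLM + T.toCLM := rfl

theorem toCLM_smul (z : ℂ) (T : AdjointableOp A X) : (z • T).toCLM = z • T.toCLM := rfl

theorem norm_toCLM (T : AdjointableOp A X) : ‖T.toCLM‖ = ‖T‖ := rfl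

theorem isometry_toCLM : Isometry (toCLM : AdjointableOp A X → X →L[ℂ] X) := isometry_subtype_coe

/-- The adjoint operator. -/
instance : Star (AdjointableOp A X) where
  star T := ⟨T.2.choose, T.1, T.2.choose_spec.symm A⟩

theorem isAdjointPair_star (T : AdjointableOp A X) : IsAdjointPair A T.toCLM (star T).toCLM :=
  T.2.choose_spec

theorem star_eq_of_isAdjointPair {T S : AdjointableOp A X}
    (h : IsAdjointPair A T.toCLM S.toCLM) : star T = S :=
  toCLM_injective ((isAdjointPair_star T).unique A h)

instance : StarRing (AdjointableOp A X) where
  star_involutive T := star_eq_of_isAdjointPair ((isAdjointPair_star T).symm A)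
  star_mul T T' := star_eq_of_isAdjointPair fun x y => by
    simp [toCLM_mul, isAdjointPair_star T _ _, isAdjointPair_star T' _ _]
  star_add T T' := star_eq_of_isAdjointPair fun x y => by
    simp [toCLM_add, isAdjointPair_star T _ _, isAdjointPair_star T' _ _]

instance : StarModule ℂ (AdjointableOp A X) where
  star_smul z T := star_eq_of_isAdjointPair fun x y => by
    simp [toCLM_smul, isAdjointPair_star T _ _]

instance : CStarRing (AdjointableOp A X) where
  norm_mul_self_le T := by
    have key : ‖T.toCLM‖ ≤ √‖star T * T‖ := by
      refine ContinuousLinearMap.opNorm_le_bound _ (Real.sqrt_nonneg _) fun x => ?_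
      have h1 : ‖T.toCLM x‖ ^ 2 ≤ ‖star T * T‖ * ‖x‖ ^ 2 := by
        rw [CStarModule.norm_sq_eq A, isAdjointPair_star T]
        calc _ ≤ ‖x‖ * ‖(star T * T).toCLM x‖ := CStarModule.norm_inner_le X
          _ ≤ ‖x‖ * (‖star T * T‖ * ‖x‖) := by
              gcongr
              exact ContinuousLinearMap.le_opNorm _ _
          _ = _ := by ring
      refine (sq_le_sq₀ (norm_nonneg _) (by positivity)).1 ?_
      rwa [mul_pow, Real.sq_sqrt (norm_nonneg _)]
    calc ‖T‖ * ‖T‖ ≤ √‖star T * T‖ * √‖star T * T‖ :=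
          mul_le_mul key key (norm_nonneg _) (Real.sqrt_nonneg _)
      _ = _ := Real.mul_self_sqrt (norm_nonneg _)

instance [CompleteSpace X] : CompleteSpace (AdjointableOp A X) := by
  refine Metric.complete_of_cauchySeq_tendsto fun u hu => ?_
  have hv : CauchySeq fun n => star (u n) := by
    rw [Metric.cauchySeq_iff] at hu ⊢
    simpa only [dist_eq_norm, ← star_sub, norm_star] using hu
  obtain ⟨T, hT⟩ := cauchySeq_tendsto_of_complete
    (u := fun n => (u n).toCLM) (hu.map isometry_toCLM.uniformContinuous)
  obtain ⟨S, hS⟩ := cauchySeq_tendsto_of_complete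
    (u := fun n => (star (u n)).toCLM) (hv.map isometry_toCLM.uniformContinuous)
  have hTS : IsAdjointPair A T S := fun x y => by
    have h1 : Filter.Tendsto (fun n => inner A ((u n).toCLM x) y) Filter.atTop
        (nhds (inner A (T x) y)) :=
      (CStarModule.continuous_inner (A := A) (E := X)).continuousAt.tendsto.comp
        ((((ContinuousLinearMap.apply ℂ X x).continuous.tendsto T).comp hT).prodMk_nhds
          tendsto_const_nhds)
    have h2 : Filter.Tendsto (fun n => inner A x ((star (u n)).toCLM y))
        Filter.atTop (nhds (inner A x (S y))) :=
      (CStarModule.continuous_inner (A := A) (E := X)).continuousAt.tendsto.comp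
        ((tendsto_const_nhds (x := x)).prodMk_nhds
          (((ContinuousLinearMap.apply ℂ X y).continuous.tendsto S).comp hS))
    refine tendsto_nhds_unique h1 (h2.congr fun n => ?_)
    exact (isAdjointPair_star (u n) x y).symm
  exact ⟨⟨T, S, hTS⟩, isometry_toCLM.isEmbedding.tendsto_nhds_iff.2 hT⟩

instance [CompleteSpace X] : CStarAlgebra (AdjointableOp A X) where

/-- The order of the C*-algebra of bounded adjointable operators: `S ≤ T` if and only if `T - S`
is a positive element, that is, selfadjoint with spectrum in `[0, ∞)`. -/
instance [CompleteSpace X] : PartialOrder (AdjointableOp A X) := CStarAlgebra.spectralOrder _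

instance [CompleteSpace X] : StarOrderedRing (AdjointableOp A X) :=
  CStarAlgebra.spectralOrderedRing _

end AdjointableOp

/-! ### Unbounded operators -/

/-- The pairs `(y, x)` with `⟪T ξ, y⟫ = ⟪ξ, x⟫` for all `ξ` in the domain of `T`: the graph of the
adjoint of `T` when `T` is densely defined. -/
def adjointGraph (T : X →ₗ.[ℂ] Y) : Submodule ℂ (Y × X) where
  carrier := {p | ∀ ξ : T.domain, inner A (T ξ) p.1 = inner A (ξ : X) p.2}
  add_mem' := by
    intro p q hp hq ξ
    simp [hp ξ, hq ξ]
  zero_mem' := by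
    intro ξ
    simp
  smul_mem' := by
    intro z p hp ξ
    simp [hp ξ]

/-- The adjoint `T*` of a densely defined unbounded operator `T`, with respect to the `A`-valued
inner products. -/
def adjoint (T : X →ₗ.[ℂ] Y) : Y →ₗ.[ℂ] X := (adjointGraph A T).toLinearPMap

/-- A densely defined operator with `T* = T` (same domain and same values). -/
def IsSelfAdjoint (T : X →ₗ.[ℂ] X) : Prop :=
  Dense (T.domain : Set X) ∧ adjoint A T = T

/-- A regular operator: closed, `A`-linear, densely defined with densely defined adjoint, and such
that `1 + T* T` has dense image. -/
structure IsRegular (T : X →ₗ.[ℂ] Y) : Prop where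
  isClosed : T.IsClosed
  smul_mem : ∀ (a : A) (x : X), x ∈ T.domain → a • x ∈ T.domain
  map_smul : ∀ (a : A) (x : T.domain), T ⟨a • (x : X), smul_mem a x x.2⟩ = a • T x
  dense_domain : Dense (T.domain : Set X)
  dense_adjoint_domain : Dense ((adjoint A T).domain : Set Y)
  dense_image : Dense {z : X | ∃ (x : T.domain) (hx : T x ∈ (adjoint A T).domain),
    z = (x : X) + adjoint A T ⟨T x, hx⟩}

/-- The operator `S D T` for bounded `T : X → Y` and `S : Y → X`, with domain all `x` such that
`T x` is in the domain of `D`. -/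
def sandwich (S : Y →L[ℂ] X) (D : Y →ₗ.[ℂ] Y) (T : X →L[ℂ] Y) : X →ₗ.[ℂ] X where
  domain := D.domain.comap (T : X →ₗ[ℂ] Y)
  toFun := (S : Y →ₗ[ℂ] X) ∘ₗ D.toFun ∘ₗ (T : X →ₗ[ℂ] Y).submoduleComap D.domain

/-- The modular lift of `D` with respect to `Φ` (with adjoint `Φs`): the closure of `Φ* D Φ`. -/
def modularLift (Φs : Y →L[ℂ] X) (D : Y →ₗ.[ℂ] Y) (Φ : X →L[ℂ] Y) : X →ₗ.[ℂ] X :=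
  (sandwich Φs D Φ).closure

/-- The differentiability condition on a bounded operator `G` with respect to `(D, Γ)`:

* `G Γ` leaves the domain of `D` invariant;
* the twisted commutator `D G Γ - Γ G D` extends to a bounded operator `d` on `Y`;
* the image of `d` lies in the image of `Γ^{1/2}`, and the operator `Γ^{-1/2} d Γ^{-1/2}`, defined
  on the image of `Γ^{1/2}`, extends to a bounded operator `ρ` on `Y`. (The value of
  `Γ^{-1/2} d Γ^{-1/2}` at `Γ^{1/2} η` is the element `ζ` with `Γ^{1/2} ζ = d η`.) -/
structure IsDifferentiable [CompleteSpace Y] (D : Y →ₗ.[ℂ] Y) (Γ : AdjointableOp A Y)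
    (G : Y →L[ℂ] Y) : Prop where
  invariant : ∀ η ∈ D.domain, G (Γ.toCLM η) ∈ D.domain
  factorization : ∃ d : Y →L[ℂ] Y,
    (∀ η : D.domain, d η =
      D ⟨G (Γ.toCLM η), invariant η η.2⟩ - Γ.toCLM (G (D η))) ∧
    (∀ η : Y, ∃ ζ : Y, (CFC.sqrt Γ).toCLM ζ = d η) ∧
    ∃ ρ : Y →L[ℂ] Y, ∀ η ζ : Y, (CFC.sqrt Γ).toCLM ζ = d η →
      ρ ((CFC.sqrt Γ).toCLM η) = ζ

end

end HilbertCStar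

/-!
Why the modular lift is selfadjoint and regular.

Write `γ = Γ^{1/2}` and `G = Φ Φ*`, so that `d_Γ(G) = γ ρ γ`. Formally, `Φ* D Φ = Ψ* S Ψ` with
`S = γ⁻¹ D γ⁻¹` and `Ψ = γ Φ`, and the hypotheses say that the commutator of `S` with
`H = Ψ Ψ* = γ G γ` is the bounded operator `ρ`: the twist by `Γ` disappears. The operator `S` may
fail to make sense, but its resolvents can be replaced by the compressions `γ Q γ` of
`Q = (D + i (μ Γ + μ⁻³))⁻¹`, which exist because `D` is selfadjoint and regular. They satisfy
`‖γ Q γ‖ ≤ |μ|⁻¹`, and their commutator with `H` is `γ Q γ ρ γ Q γ` up to a negligible error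
(`IsTwistedResolvent.norm_commutator_le`): the summand `μ Γ` commutes with `G Γ` in the twisted
sense, and `μ⁻³` is too small to matter.

By the closability and density arguments that work as in Hilbert spaces, it is enough that
`T = Φ* D Φ` is symmetric and densely defined and that `T + iλ` has dense range for all real `λ` of
large modulus (`IsSymm.addSurjective_of_dense`, `IsSymm.isSelfAdjoint_and_isRegular`); surjectivity
then passes to all `λ ≠ 0` by a Neumann series. Let `S_μ` and `P_μ` be the bounded selfadjoint
operators built from the resolvents at `±μ` that stand for `μ² S (μ² + S²)⁻¹` and `μ² (μ² + S²)⁻¹`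
(`boundedApprox`, `cutoff`). The commutator of `S_μ` with `H` is bounded uniformly in `μ`, so
`H S_μ + ρ P_μ + iλ` is a bounded perturbation of a selfadjoint operator plus `iλ`, and
`(H S_μ + ρ P_μ + iλ) y = v` has a solution with `‖y‖ ≤ ‖v‖` for large `|λ|`. It yields `x` in the
domain of `T` with `(T + iλ) x = Φ* γ v + iλ Φ* γ (P_μ - 1) y + O(μ⁻¹)`
(`exists_approx_solution`).

The error is bounded, and its inner products with fixed vectors tend to `0` in norm, as `P_μ → 1`
strongly on the closure of the image of `γ Φ` (`IsTwistedResolvent.norm_sub_le`). In a Hilbert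
C*-module this still suffices: by the Banach–Saks argument (`mem_closure_of_weak_limit`), averages
of the errors tend to `0` in norm. Hence `Φ* γ v` lies in the closure of the range of `T + iλ`, and
such vectors are dense. No localization to Hilbert spaces is needed.
-/

namespace HilbertCStar

noncomputable section

variable (A : Type*) [NonUnitalCStarAlgebra A] [PartialOrder A] [StarOrderedRing A]
variable {X : Type*} [NormedAddCommGroup X] [NormedSpace ℂ X] [SMul A X] [CStarModule A X]
variable {Y : Type*} [NormedAddCommGroup Y] [NormedSpace ℂ Y] [SMul A Y] [CStarModule A Y]

open Filter Topology Complex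

/-! ### Norm estimates and weak limits in Hilbert C*-modules -/

theorem norm_inner_comm (x y : X) : ‖inner A x y‖ = ‖inner A y x‖ := by
  rw [← CStarModule.star_inner, norm_star]

/-- A version of the Banach–Saks theorem: if a submodule contains `z + b n` for a bounded sequence
`b` that converges weakly to `0` against the `A`-valued inner product, then averages of the `b n`
along a sufficiently sparse subsequence tend to `0` in norm, so `z` is in the closure. -/
theorem mem_closure_of_weak_limit (S : Submodule ℂ X) {z : X} {b : ℕ → X} {M : ℝ}
    (hM : ∀ n, ‖b n‖ ≤ M) (hb : ∀ w : X, Tendsto (fun n => inner A w (b n)) atTop (𝓝 0))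
    (hS : ∀ n, z + b n ∈ S) : z ∈ closure (S : Set X) := by
  have key : ∀ N : ℕ, ∃ s : X, (N : ℂ) • z + s ∈ S ∧ ‖s‖ ^ 2 ≤ N * (M ^ 2 + 1) := by
    intro N
    induction N with
    | zero => exact ⟨0, by simp, by simp⟩
    | succ N ih =>
      obtain ⟨s, hs, hs'⟩ := ih
      have h1 := (hb s).norm
      rw [norm_zero] at h1
      obtain ⟨n, hn⟩ := (h1.eventually (gt_mem_nhds (show (0 : ℝ) < 1 / 2 by norm_num))).exists
      refine ⟨s + b n, ?_, ?_⟩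
      · have := S.add_mem hs (hS n)
        convert this using 1
        push_cast
        module
      · have h2 : ‖s + b n‖ ^ 2 ≤ ‖s‖ ^ 2 + ‖inner A s (b n)‖ + ‖inner A (b n) s‖ + ‖b n‖ ^ 2 := by
          rw [CStarModule.norm_sq_eq A, CStarModule.norm_sq_eq A, CStarModule.norm_sq_eq A]
          simp only [CStarModule.inner_add_left, CStarModule.inner_add_right]
          calc _ = ‖inner A s s + inner A s (b n) + inner A (b n) s + inner A (b n) (b n)‖ := by
                congr 1; abel
            _ ≤ _ := norm_add₄_le
        rw [norm_inner_comm A (b n) s] at h2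
        have h3 : ‖b n‖ ^ 2 ≤ M ^ 2 := pow_le_pow_left₀ (norm_nonneg _) (hM n) 2
        push_cast
        linarith
  choose s hs hs' using key
  have h0 : Tendsto (fun N : ℕ => ((N + 1 : ℕ) : ℂ)⁻¹ • s (N + 1)) atTop (𝓝 0) := by
    rw [tendsto_zero_iff_norm_tendsto_zero]
    have h1 : Tendsto (fun N : ℕ => √((M ^ 2 + 1) * (1 / ((N : ℝ) + 1)))) atTop (𝓝 0) := by
      have := (tendsto_one_div_add_atTop_nhds_zero_nat (𝕜 := ℝ)).const_mul (M ^ 2 + 1)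
      simpa using this.sqrt
    refine squeeze_zero (fun _ => norm_nonneg _) (fun N => ?_) h1
    refine Real.le_sqrt_of_sq_le ?_
    have h2 := hs' (N + 1)
    rw [norm_smul, norm_inv, Complex.norm_natCast, mul_pow]
    push_cast at h2 ⊢
    have hN : (0 : ℝ) < (N : ℝ) + 1 := by positivity
    calc (((N : ℝ) + 1)⁻¹) ^ 2 * ‖s (N + 1)‖ ^ 2
        ≤ (((N : ℝ) + 1)⁻¹) ^ 2 * (((N : ℝ) + 1) * (M ^ 2 + 1)) := by gcongr
      _ = _ := by field_simp
  have h1 : Tendsto (fun N : ℕ => z + ((N + 1 : ℕ) : ℂ)⁻¹ • s (N + 1)) atTop (𝓝 z) := by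
    simpa using h0.const_add z
  refine mem_closure_of_tendsto h1 (Eventually.of_forall fun N => ?_)
  have h2 := S.smul_mem (((N + 1 : ℕ) : ℂ)⁻¹) (hs (N + 1))
  rwa [smul_add, smul_smul, inv_mul_cancel₀ (by exact_mod_cast N.succ_ne_zero), one_smul] at h2

/-! ### Symmetric operators -/

/-- An unbounded operator is symmetric if `⟪T x, x'⟫ = ⟪x, T x'⟫` on its domain. It is formulated
through the graph, which avoids subtypes. -/
def IsSymm (T : X →ₗ.[ℂ] X) : Prop :=
  ∀ ⦃x y x' y' : X⦄, (x, y) ∈ T.graph → (x', y') ∈ T.graph → inner A y x' = inner A x y'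

variable {A}

theorem mem_adjointGraph {T : X →ₗ.[ℂ] Y} {y : Y} {x : X} :
    (y, x) ∈ adjointGraph A T ↔
      ∀ ξ η, (ξ, η) ∈ T.graph → inner A η y = inner A ξ x := by
  constructor
  · intro h ξ η hξ
    obtain ⟨u, rfl, rfl⟩ := (LinearPMap.mem_graph_iff _).1 hξ
    exact h u
  · intro h u
    exact h _ _ (T.mem_graph u)

theorem isClosed_adjointGraph (T : X →ₗ.[ℂ] Y) :
    _root_.IsClosed (adjointGraph A T : Set (Y × X)) := by
  have : (adjointGraph A T : Set (Y × X)) =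
      ⋂ ξ : T.domain, {p | inner A (T ξ) p.1 = inner A (ξ : X) p.2} := by
    ext p
    simp [adjointGraph]
  rw [this]
  refine isClosed_iInter fun ξ => isClosed_eq ?_ ?_
  · exact CStarModule.continuous_inner.comp (continuous_const.prodMk continuous_fst)
  · exact CStarModule.continuous_inner.comp (continuous_const.prodMk continuous_snd)

theorem eq_zero_of_inner_dense {S : Set X} (hS : Dense S) {z : X}
    (h : ∀ x ∈ S, inner A x z = 0) : z = 0 := by
  have h1 : Continuous fun x : X => inner A x z :=
    CStarModule.continuous_inner.comp (continuous_id.prodMk continuous_const)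
  have h2 := h1.ext_on hS continuous_const h
  exact CStarModule.inner_self.1 (congrFun h2 z)

theorem graph_adjoint {T : X →ₗ.[ℂ] Y} (hT : Dense (T.domain : Set X)) :
    (adjoint A T).graph = adjointGraph A T := by
  refine Submodule.toLinearPMap_graph_eq _ fun p hp h0 => ?_
  refine eq_zero_of_inner_dense (A := A) hT fun x hx => ?_
  rw [← hp ⟨x, hx⟩, h0, CStarModule.inner_zero_right]

theorem IsSelfAdjoint.graph_eq {T : X →ₗ.[ℂ] X} (hT : IsSelfAdjoint A T) :
    T.graph = adjointGraph A T := by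
  rw [← graph_adjoint hT.1, hT.2]

theorem IsSelfAdjoint.isSymm {T : X →ₗ.[ℂ] X} (hT : IsSelfAdjoint A T) : IsSymm A T := by
  intro x y x' y' h h'
  rw [hT.graph_eq] at h'
  exact mem_adjointGraph.1 h' _ _ h

theorem IsSymm.graph_le {T : X →ₗ.[ℂ] X} (hT : IsSymm A T) : T.graph ≤ adjointGraph A T :=
  fun ⟨_, _⟩ h => mem_adjointGraph.2 fun _ _ h' => hT h' h

theorem IsSymm.isClosable {T : X →ₗ.[ℂ] X} (hT : IsSymm A T) (hd : Dense (T.domain : Set X)) :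
    T.IsClosable := by
  refine LinearPMap.isClosable_iff_exists_closed_extension.2 ⟨adjoint A T, ?_, ?_⟩
  · rw [LinearPMap.IsClosed, graph_adjoint hd]
    exact isClosed_adjointGraph T
  · exact LinearPMap.le_of_le_graph (by rw [graph_adjoint hd]; exact hT.graph_le)

theorem IsSymm.closure {T : X →ₗ.[ℂ] X} (hT : IsSymm A T) (hc : T.IsClosable) :
    IsSymm A T.closure := by
  intro x y x' y' h h'
  rw [← hc.graph_closure_eq_closure_graph] at h h'
  have h1 : ∀ p ∈ T.graph, inner A p.2 x' = inner A p.1 y' := by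
    intro p hp
    have : T.graph.topologicalClosure ≤ adjointGraph A T :=
      Submodule.topologicalClosure_minimal _ hT.graph_le (isClosed_adjointGraph T)
    exact mem_adjointGraph.1 (this h') p.1 p.2 hp
  have h2 : _root_.IsClosed {p : X × X | inner A p.2 x' = inner A p.1 y'} :=
    isClosed_eq (CStarModule.continuous_inner.comp (continuous_snd.prodMk continuous_const))
      (CStarModule.continuous_inner.comp (continuous_fst.prodMk continuous_const))
  exact closure_minimal (s := (T.graph : Set (X × X))) h1 h2 h

/-- The skew part of `⟪ξ, (T + i B) ξ⟫` is `2 i ⟪ξ, B ξ⟫`. -/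
theorem IsSymm.norm_inner_le {T : X →ₗ.[ℂ] X} (hT : IsSymm A T) {B : X →L[ℂ] X}
    (hB : IsAdjointPair A B B) {x y : X} (h : (x, y) ∈ T.graph) :
    ‖inner A x (B x)‖ ≤ ‖inner A x (y + I • B x)‖ := by
  have h1 : inner A x (y + I • B x) - inner A (y + I • B x) x = (2 * I) • inner A x (B x) := by
    simp only [CStarModule.inner_add_right, CStarModule.inner_add_left,
      CStarModule.inner_smul_left_complex, CStarModule.inner_smul_right_complex, hT h h, hB x x,
      Complex.star_def, Complex.conj_I]
    module
  have h2 := norm_sub_le (inner A x (y + I • B x)) (inner A (y + I • B x) x)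
  rw [h1, norm_inner_comm A (y + I • B x) x, norm_smul, norm_mul,
    Complex.norm_I, mul_one, Complex.norm_ofNat] at h2
  linarith

theorem IsSymm.norm_le {T : X →ₗ.[ℂ] X} (hT : IsSymm A T) (c : ℝ) {x y : X}
    (h : (x, y) ∈ T.graph) : |c| * ‖x‖ ≤ ‖y + ((c : ℂ) * I) • x‖ := by
  have hB : IsAdjointPair A ((c : ℂ) • (1 : X →L[ℂ] X)) ((c : ℂ) • (1 : X →L[ℂ] X)) :=
    fun u v => by simp
  have h1 := hT.norm_inner_le hB h
  simp only [smul_apply, one_apply_eq_self, smul_smul,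
    CStarModule.inner_smul_right_complex, norm_smul, ← CStarModule.norm_sq_eq A,
    Complex.norm_real, Real.norm_eq_abs] at h1
  rw [mul_comm I] at h1
  have h2 := h1.trans (CStarModule.norm_inner_le (A := A) X)
  rcases (norm_nonneg x).eq_or_lt with h0 | h0
  · rw [← h0]; simp
  · exact le_of_mul_le_mul_left (by linarith) h0

/-! ### Surjectivity of perturbed operators -/

/-- The operator `T + E`, for a bounded operator `E`, is onto. -/
def AddSurjective (T : X →ₗ.[ℂ] X) (E : X →L[ℂ] X) : Prop :=
  ∀ v : X, ∃ x y : X, (x, y) ∈ T.graph ∧ y + E x = v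

/-- If `T + E` is onto and bounded below, it has a bounded inverse. -/
theorem AddSurjective.exists_inverse {T : X →ₗ.[ℂ] X} {E : X →L[ℂ] X} (hs : AddSurjective T E)
    {c : ℝ} (hc : 0 < c) (hlow : ∀ x y, (x, y) ∈ T.graph → c * ‖x‖ ≤ ‖y + E x‖) :
    ∃ Q : X →L[ℂ] X, (∀ v, (Q v, v - E (Q v)) ∈ T.graph) ∧
      (∀ x y, (x, y) ∈ T.graph → Q (y + E x) = x) ∧ ‖Q‖ ≤ c⁻¹ := by
  have huniq : ∀ x y x' y', (x, y) ∈ T.graph → (x', y') ∈ T.graph → y + E x = y' + E x' →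
      x = x' := by
    intro x y x' y' h h' he
    have h1 := hlow _ _ (T.graph.sub_mem h h')
    have h2 : y - y' + E (x - x') = 0 := by
      rw [map_sub, ← sub_eq_zero.2 he]; abel
    rw [h2, norm_zero] at h1
    have h3 : ‖x - x'‖ ≤ 0 := by
      by_contra h4
      nlinarith [mul_pos hc (not_le.1 h4)]
    exact sub_eq_zero.1 (norm_le_zero_iff.1 h3)
  choose q q' hq hq' using hs
  have hleft : ∀ x y, (x, y) ∈ T.graph → q (y + E x) = x := fun x y h =>
    huniq _ _ _ _ (hq _) h (hq' _)
  let L : X →ₗ[ℂ] X :=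
    { toFun := q
      map_add' := fun u v => huniq _ _ _ _ (hq _) (T.graph.add_mem (hq u) (hq v)) (by
        rw [hq', map_add, add_add_add_comm, hq', hq'])
      map_smul' := fun z u => huniq _ _ _ _ (hq _) (T.graph.smul_mem z (hq u)) (by
        rw [hq', RingHom.id_apply, map_smul, ← smul_add, hq']) }
  have hL : ∀ v, ‖L v‖ ≤ c⁻¹ * ‖v‖ := fun v => by
    rw [inv_mul_eq_div, le_div_iff₀' hc]
    have h := hlow _ _ (hq v)
    rwa [hq'] at h
  refine ⟨L.mkContinuous c⁻¹ hL, fun v => ?_, fun x y h => hleft x y h,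
    LinearMap.mkContinuous_norm_le _ (inv_nonneg.2 hc.le) _⟩
  have : v - E (q v) = q' v := by rw [sub_eq_iff_eq_add, hq']
  change (q v, v - E (q v)) ∈ _
  rw [this]
  exact hq v

/-- Neumann series: a perturbation of norm less than `|ν|` preserves surjectivity of `T + iν`. -/
theorem AddSurjective.add [CompleteSpace X] {T : X →ₗ.[ℂ] X} (hT : IsSymm A T) {ν : ℝ}
    (hs : AddSurjective T (((ν : ℂ) * I) • (1 : X →L[ℂ] X))) {E : X →L[ℂ] X} (hE : ‖E‖ < |ν|) :
    AddSurjective T (((ν : ℂ) * I) • (1 : X →L[ℂ] X) + E) := by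
  have hν : 0 < |ν| := (norm_nonneg _).trans_lt hE
  obtain ⟨Q, hQ, -, hQn⟩ := hs.exists_inverse hν fun x y h => by simpa using hT.norm_le ν h
  have h1 : ‖-(E * Q)‖ < 1 := by
    rw [norm_neg]
    calc ‖E * Q‖ ≤ ‖E‖ * ‖Q‖ := norm_mul_le _ _
      _ ≤ ‖E‖ * |ν|⁻¹ := by gcongr
      _ < 1 := by rwa [← div_eq_mul_inv, div_lt_one hν]
  intro v
  let U := Units.oneSub (-(E * Q)) h1
  refine ⟨Q ((U⁻¹ : (X →L[ℂ] X)ˣ).1 v), _, hQ _, ?_⟩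
  have h2 : (U : X →L[ℂ] X) ((U⁻¹ : (X →L[ℂ] X)ˣ).1 v) = v := by
    rw [← mul_apply_eq_comp, Units.mul_inv, one_apply_eq_self]
  have h3 : (U : X →L[ℂ] X) = 1 + E * Q := by simp [U]
  rw [h3] at h2
  simp only [add_apply, one_apply_eq_self,
    mul_apply_eq_comp] at h2
  rw [add_apply]
  conv_rhs => rw [← h2]
  abel

/-- If `T + iν` is onto, then so is `T + itν` for all `t > 0`. -/
theorem AddSurjective.mul_pos [CompleteSpace X] {T : X →ₗ.[ℂ] X} (hT : IsSymm A T) {ν : ℝ}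
    (hν : ν ≠ 0) (hs : AddSurjective T (((ν : ℂ) * I) • (1 : X →L[ℂ] X))) {t : ℝ} (ht : 0 < t) :
    AddSurjective T ((((t * ν : ℝ) : ℂ) * I) • (1 : X →L[ℂ] X)) := by
  have step : ∀ s t : ℝ, 0 < s → 0 < t → t < 2 * s →
      AddSurjective T ((((s * ν : ℝ) : ℂ) * I) • (1 : X →L[ℂ] X)) →
      AddSurjective T ((((t * ν : ℝ) : ℂ) * I) • (1 : X →L[ℂ] X)) := by
    intro s t hs ht hst h
    have h1 : ‖((((t - s) * ν : ℝ) : ℂ) * I) • (1 : X →L[ℂ] X)‖ < |s * ν| := by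
      rw [norm_smul]
      calc _ ≤ |(t - s) * ν| * 1 := by
            rw [norm_mul, Complex.norm_I, mul_one, Complex.norm_real, Real.norm_eq_abs]
            gcongr
            exact ContinuousLinearMap.norm_id_le
        _ < _ := by
            rw [mul_one, abs_mul, abs_mul]
            refine mul_lt_mul_of_pos_right ?_ (abs_pos.2 hν)
            rw [abs_of_pos hs, abs_lt]
            constructor <;> linarith
    have h2 := h.add hT h1
    rw [← add_smul, ← add_mul, ← Complex.ofReal_add, ← add_mul, add_sub_cancel] at h2
    exact h2
  have main : ∀ n : ℕ, ∀ t : ℝ, 0 < t → t < 2 ^ (n + 1) →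
      AddSurjective T ((((t * ν : ℝ) : ℂ) * I) • (1 : X →L[ℂ] X)) := by
    intro n
    induction n with
    | zero =>
      intro t ht ht2
      exact step 1 t one_pos ht (by simpa using ht2) (by simpa using hs)
    | succ n ih =>
      intro t ht ht2
      rw [pow_succ] at ht2
      obtain ⟨s, h1, h2⟩ := exists_between (show t / 2 < 2 ^ (n + 1) by linarith)
      exact step s t (by linarith) ht (by linarith) (ih s (by linarith) h2)
  obtain ⟨n, hn⟩ := pow_unbounded_of_one_lt t (one_lt_two (α := ℝ))
  exact main n t ht (hn.trans (pow_lt_pow_right₀ one_lt_two n.lt_succ_self))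

/-- For a closed symmetric operator `T`, the operator `T + ic` is bounded below, so it is onto as
soon as its range is dense. -/
theorem IsSymm.addSurjective_of_dense [CompleteSpace X] {T : X →ₗ.[ℂ] X} (hT : IsSymm A T)
    (hc : T.IsClosed) {c : ℝ} (h0 : c ≠ 0)
    (hd : Dense {v : X | ∃ x y, (x, y) ∈ T.graph ∧ y + ((c : ℂ) * I) • x = v}) :
    AddSurjective T (((c : ℂ) * I) • (1 : X →L[ℂ] X)) := by
  intro v
  obtain ⟨u, hu, hlim⟩ := mem_closure_iff_seq_limit.1 (hd v)
  choose x y hxy hu using hu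
  have hc0 : 0 < |c| := abs_pos.2 h0
  have hx : CauchySeq x := by
    have h1 := hlim.cauchySeq
    rw [Metric.cauchySeq_iff] at h1 ⊢
    intro ε hε
    obtain ⟨N, hN⟩ := h1 (|c| * ε) (by positivity)
    refine ⟨N, fun m hm n hn => ?_⟩
    have h2 := hN m hm n hn
    have h3 := hT.norm_le c (T.graph.sub_mem (hxy m) (hxy n))
    have h4 : y m - y n + ((c : ℂ) * I) • (x m - x n) = u m - u n := by
      rw [← hu, ← hu, smul_sub]; abel
    rw [h4, ← dist_eq_norm, ← dist_eq_norm] at h3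
    exact lt_of_mul_lt_mul_left (h3.trans_lt h2) hc0.le
  obtain ⟨a, ha⟩ := cauchySeq_tendsto_of_complete hx
  have hy : Tendsto y atTop (𝓝 (v - ((c : ℂ) * I) • a)) := by
    have := hlim.sub (ha.const_smul ((c : ℂ) * I))
    refine this.congr fun n => ?_
    rw [← hu]; abel
  refine ⟨a, _, hc.mem_of_tendsto (ha.prodMk_nhds hy) (Eventually.of_forall hxy), ?_⟩
  simp

theorem IsRegular.addSurjective [CompleteSpace X] {T : X →ₗ.[ℂ] X} (hsa : IsSelfAdjoint A T)
    (hr : IsRegular A T) {c : ℝ} (h0 : c ≠ 0) :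
    AddSurjective T (((c : ℂ) * I) • (1 : X →L[ℂ] X)) := by
  have key : ∀ s : ℝ, s * s = 1 → AddSurjective T (((s : ℂ) * I) • (1 : X →L[ℂ] X)) := by
    intro s hs
    have hs0 : s ≠ 0 := by rintro rfl; simp at hs
    refine hsa.isSymm.addSurjective_of_dense hr.isClosed hs0 ?_
    refine hr.dense_image.mono ?_
    rintro z ⟨x, hx, rfl⟩
    have h1 : ((x : X), T x) ∈ T.graph := T.mem_graph x
    have h2 : (T x, adjoint A T ⟨T x, hx⟩) ∈ T.graph := by
      have := (adjoint A T).mem_graph ⟨T x, hx⟩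
      rwa [graph_adjoint hsa.1, ← hsa.graph_eq] at this
    -- `1 + T² = (T + is)(T - is)` for `s = ±1`
    refine ⟨T x - ((s : ℂ) * I) • (x : X), adjoint A T ⟨T x, hx⟩ - ((s : ℂ) * I) • T x,
      T.graph.sub_mem h2 (T.graph.smul_mem ((s : ℂ) * I) h1), ?_⟩
    have h3 : ((s : ℂ) * I) * ((s : ℂ) * I) = -1 := by
      rw [mul_mul_mul_comm, I_mul_I, ← Complex.ofReal_mul, hs]; simp
    simp only [smul_sub, smul_smul, h3]
    module
  rcases h0.lt_or_gt with h | h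
  · have := (key (-1) (by norm_num)).mul_pos hsa.isSymm (by norm_num) (neg_pos.2 h)
    simpa using this
  · have := (key 1 (by norm_num)).mul_pos hsa.isSymm (by norm_num) h
    simpa using this

/-- A closed symmetric densely defined operator for which `T ± iλ` are onto is selfadjoint and
regular. -/
theorem IsSymm.isSelfAdjoint_and_isRegular [CompleteSpace X] {T : X →ₗ.[ℂ] X} (hT : IsSymm A T)
    (hd : Dense (T.domain : Set X)) (hs : ∀ c : ℝ, c ≠ 0 →
      AddSurjective T (((c : ℂ) * I) • (1 : X →L[ℂ] X))) :
    IsSelfAdjoint A T ∧ IsRegular A T := by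
  have hg : adjointGraph A T = T.graph := by
    refine le_antisymm ?_ hT.graph_le
    rintro ⟨y, w⟩ hy
    rw [mem_adjointGraph] at hy
    obtain ⟨x, x', hx, he⟩ := hs (-1) (by norm_num) (w - I • y)
    have he' : w = x' + I • (y - x) := by
      simp at he
      rw [smul_sub, ← sub_eq_zero]
      have := sub_eq_zero.2 he.symm
      rw [← this]
      abel
    -- `y - x` is orthogonal to the range of `T + i`, which is everything
    obtain ⟨ξ, η, hξ, hη⟩ := hs 1 one_ne_zero (y - x)
    have h1 : inner A (y - x) (y - x) = 0 := by
      have h2 := hy _ _ hξ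
      have h3 := hT hξ hx
      have h4 : inner A (y - x) (y - x) = inner A (η + (((1 : ℝ) : ℂ) * I) • ξ) (y - x) :=
        congrArg (fun u => inner A u (y - x)) hη.symm
      rw [h4]
      simp only [CStarModule.inner_add_left, CStarModule.inner_smul_left_complex,
        CStarModule.inner_sub_right, h2, h3, he', CStarModule.inner_add_right,
        CStarModule.inner_smul_right_complex]
      simp
      module
    have h4 : y = x := sub_eq_zero.1 (CStarModule.inner_self.1 h1)
    rw [he', h4, sub_self, smul_zero, add_zero]
    exact hx
  have hsa : adjoint A T = T := by
    refine LinearPMap.eq_of_eq_graph ?_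
    rw [graph_adjoint hd, hg]
  have hsm : ∀ (a : A) (x y : X), (x, y) ∈ T.graph → (a • x, a • y) ∈ T.graph := by
    intro a x y h
    rw [← hg, mem_adjointGraph] at h ⊢
    intro ξ η hξ
    rw [CStarModule.inner_op_smul_right, CStarModule.inner_op_smul_right, h _ _ hξ]
  refine ⟨⟨hd, hsa⟩, ?_, ?_, ?_, hd, ?_, ?_⟩
  · rw [LinearPMap.IsClosed, ← hg]
    exact isClosed_adjointGraph T
  · intro a x hx
    exact LinearPMap.mem_domain_of_mem_graph (hsm a _ _ (T.mem_graph ⟨x, hx⟩))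
  · intro a x
    exact (LinearPMap.image_iff (LinearPMap.mem_domain_of_mem_graph
      (hsm a _ _ (T.mem_graph x)))).2 (hsm a _ _ (T.mem_graph x)) |>.symm
  · rwa [hsa]
  · refine dense_iff_closure_eq.2 (Set.eq_univ_of_forall fun z => subset_closure ?_)
    obtain ⟨u, u', hu, hz⟩ := hs (-1) (by norm_num) z
    obtain ⟨x, x', hx, hxu⟩ := hs 1 one_ne_zero u
    simp at hz hxu
    have h1 : (x', u' - I • x') ∈ T.graph := by
      have := T.graph.sub_mem hu (T.graph.smul_mem I hx)
      rwa [Prod.smul_mk, Prod.mk_sub_mk, ← hxu, add_sub_cancel_right] at this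
    obtain ⟨x, rfl, rfl⟩ := (LinearPMap.mem_graph_iff _).1 hx
    rw [← graph_adjoint hd] at hg
    have h2 := h1
    rw [← hg] at h2
    refine ⟨x, LinearPMap.mem_domain_of_mem_graph h2, ?_⟩
    rw [← (LinearPMap.image_iff (LinearPMap.mem_domain_of_mem_graph h2)).2 h2, ← hz, ← hxu]
    simp only [smul_add, smul_smul, I_mul_I]
    module

/-! ### Twisted resolvents -/

/-- The bounded operator `μ γ² + μ⁻³`. The exponent makes the second term negligible against the
first as `μ → ±∞`, while the product of the two coefficients is still only `μ⁻²`. -/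
def twist (γ : Y →L[ℂ] Y) (μ : ℝ) : Y →L[ℂ] Y :=
  (μ : ℂ) • (γ * γ) + (((μ ^ 3)⁻¹ : ℝ) : ℂ) • 1

theorem twist_apply (γ : Y →L[ℂ] Y) (μ : ℝ) (x : Y) :
    twist γ μ x = (μ : ℂ) • γ (γ x) + (((μ ^ 3)⁻¹ : ℝ) : ℂ) • x := rfl

theorem twist_neg (γ : Y →L[ℂ] Y) (μ : ℝ) (x : Y) : twist γ (-μ) x = -twist γ μ x := by
  have h : (-μ) ^ 3 = -μ ^ 3 := by ring
  simp only [twist_apply, h, inv_neg, Complex.ofReal_neg]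
  module

/-- `Q` is the inverse of `D + i (μ γ² + μ⁻³)`. -/
structure IsTwistedResolvent (D : Y →ₗ.[ℂ] Y) (γ : Y →L[ℂ] Y) (μ : ℝ) (Q : Y →L[ℂ] Y) :
    Prop where
  mem_graph : ∀ v, (Q v, v - I • twist γ μ (Q v)) ∈ D.graph
  left_inv : ∀ x y, (x, y) ∈ D.graph → Q (y + I • twist γ μ x) = x

theorem norm_le_norm_smul_add_smul {a b : A} (ha : 0 ≤ a) (hb : 0 ≤ b) {s t : ℝ}
    (hst : 0 < s * t) : |s| * ‖a‖ ≤ ‖(s : ℂ) • a + (t : ℂ) • b‖ := by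
  have key : ∀ s t : ℝ, 0 ≤ s → 0 ≤ t → |s| * ‖a‖ ≤ ‖(s : ℂ) • a + (t : ℂ) • b‖ := by
    intro s t hs ht
    rw [← Real.norm_eq_abs, ← norm_smul, Complex.coe_smul, Complex.coe_smul]
    exact CStarAlgebra.norm_le_norm_of_nonneg_of_le (smul_nonneg hs ha)
      (le_add_of_nonneg_right (smul_nonneg ht hb))
  rcases pos_and_pos_or_neg_and_neg_of_mul_pos hst with ⟨hs, ht⟩ | ⟨hs, ht⟩
  · exact key s t hs.le ht.le
  · have := key (-s) (-t) (neg_nonneg.2 hs.le) (neg_nonneg.2 ht.le)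
    rwa [abs_neg, Complex.ofReal_neg, Complex.ofReal_neg, neg_smul, neg_smul, ← neg_add,
      norm_neg] at this

section Estimates

variable {D : Y →ₗ.[ℂ] Y} {γ Q : Y →L[ℂ] Y} {μ : ℝ}

theorem IsAdjointPair.twist (hγ : IsAdjointPair A γ γ) (μ : ℝ) :
    IsAdjointPair A (twist γ μ) (twist γ μ) := fun x y => by
  simp [twist_apply, hγ _ _]

/-- The skew part of `⟪x, (D + i (μ γ² + μ⁻³)) x⟫` controls both `‖γ x‖` and `‖x‖`. All norm bounds
on twisted resolvents come from this. -/
theorem mul_norm_sq_le (hD : IsSymm A D) (hγ : IsAdjointPair A γ γ) (hμ : μ ≠ 0) {x y : Y}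
    (h : (x, y) ∈ D.graph) :
    |μ| * ‖γ x‖ ^ 2 ≤ ‖inner A x (y + I • twist γ μ x)‖ ∧
      (|μ| ^ 3)⁻¹ * ‖x‖ ^ 2 ≤ ‖inner A x (y + I • twist γ μ x)‖ := by
  have h1 := hD.norm_inner_le (hγ.twist μ) h
  have h2 : inner A x (twist γ μ x) =
      (μ : ℂ) • inner A (γ x) (γ x) + (((μ ^ 3)⁻¹ : ℝ) : ℂ) • inner A x x := by
    simp only [twist_apply, CStarModule.inner_add_right, CStarModule.inner_smul_right_complex,
      hγ x (γ x)]
  have h3 : 0 < μ * (μ ^ 3)⁻¹ := by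
    have : μ * (μ ^ 3)⁻¹ = (μ ^ 2)⁻¹ := by field_simp
    rw [this]; positivity
  rw [h2] at h1
  rw [CStarModule.norm_sq_eq A, CStarModule.norm_sq_eq A, ← abs_pow, ← abs_inv]
  refine ⟨(norm_le_norm_smul_add_smul CStarModule.inner_self_nonneg CStarModule.inner_self_nonneg
    h3).trans h1, le_trans ?_ h1⟩
  rw [add_comm]
  exact norm_le_norm_smul_add_smul CStarModule.inner_self_nonneg CStarModule.inner_self_nonneg
    (by rwa [mul_comm])

theorem IsTwistedResolvent.norm_mid_le (hQ : IsTwistedResolvent D γ μ Q) (hD : IsSymm A D)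
    (hγ : IsAdjointPair A γ γ) (hμ : μ ≠ 0) (u : Y) :
    ‖γ (Q (γ u))‖ ≤ |μ|⁻¹ * ‖u‖ := by
  have h1 := (mul_norm_sq_le hD hγ hμ (hQ.mem_graph (γ u))).1
  rw [sub_add_cancel, ← hγ] at h1
  have h2 := h1.trans (CStarModule.norm_inner_le (A := A) Y)
  have hm : 0 < |μ| := abs_pos.2 hμ
  rw [inv_mul_eq_div, le_div_iff₀' hm]
  rcases (norm_nonneg (γ (Q (γ u)))).eq_or_lt with h0 | h0
  · rw [← h0]; simp
  · exact le_of_mul_le_mul_left (by linarith) h0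

theorem IsTwistedResolvent.norm_right_le (hQ : IsTwistedResolvent D γ μ Q) (hD : IsSymm A D)
    (hγ : IsAdjointPair A γ γ) (hμ : μ ≠ 0) (u : Y) :
    ‖Q (γ u)‖ ≤ |μ| * ‖u‖ := by
  have h1 := (mul_norm_sq_le hD hγ hμ (hQ.mem_graph (γ u))).2
  rw [sub_add_cancel, ← hγ] at h1
  have h2 := h1.trans (CStarModule.norm_inner_le (A := A) Y)
  have hm : 0 < |μ| := abs_pos.2 hμ
  have h3 := h2.trans (mul_le_mul_of_nonneg_right (hQ.norm_mid_le hD hγ hμ u) (norm_nonneg u))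
  refine le_of_sq_le_sq ?_ (by positivity)
  rw [inv_mul_eq_div, div_le_iff₀' (by positivity)] at h3
  calc _ ≤ _ := h3
    _ = _ := by field_simp

theorem IsTwistedResolvent.norm_left_le (hQ : IsTwistedResolvent D γ μ Q) (hD : IsSymm A D)
    (hγ : IsAdjointPair A γ γ) (hμ : μ ≠ 0) (v : Y) :
    ‖γ (Q v)‖ ≤ |μ| * ‖v‖ := by
  have h1 := mul_norm_sq_le hD hγ hμ (hQ.mem_graph v)
  rw [sub_add_cancel] at h1
  have h2 := h1.1.trans (CStarModule.norm_inner_le (A := A) Y)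
  have h3 := h1.2.trans (CStarModule.norm_inner_le (A := A) Y)
  have hm : 0 < |μ| := abs_pos.2 hμ
  have h4 : ‖Q v‖ ≤ |μ| ^ 3 * ‖v‖ := by
    rw [← div_le_iff₀' (by positivity), ← inv_mul_eq_div]
    rcases (norm_nonneg (Q v)).eq_or_lt with h0 | h0
    · rw [← h0]; simp
    · exact le_of_mul_le_mul_left (by linarith) h0
  refine le_of_sq_le_sq ?_ (by positivity)
  have h5 : |μ| * ‖γ (Q v)‖ ^ 2 ≤ |μ| * (|μ| * ‖v‖) ^ 2 := by
    calc _ ≤ _ := h2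
      _ ≤ |μ| ^ 3 * ‖v‖ * ‖v‖ := by gcongr
      _ = _ := by ring
  exact le_of_mul_le_mul_left h5 hm

theorem IsTwistedResolvent.isAdjointPair {Q' : Y →L[ℂ] Y} (hQ : IsTwistedResolvent D γ μ Q)
    (hQ' : IsTwistedResolvent D γ (-μ) Q') (hD : IsSymm A D) (hγ : IsAdjointPair A γ γ) :
    IsAdjointPair A Q Q' := by
  intro u v
  have h := hD (hQ.mem_graph u) (hQ'.mem_graph v)
  simp only [CStarModule.inner_sub_left, CStarModule.inner_sub_right, twist_neg, smul_neg,
    CStarModule.inner_neg_right, CStarModule.inner_smul_left_complex,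
    CStarModule.inner_smul_right_complex, hγ.twist μ (Q u) (Q' v), Complex.star_def,
    Complex.conj_I] at h
  have h' := sub_eq_zero.2 h
  rw [eq_comm, ← sub_eq_zero, ← h']
  module

/-- The commutator of the compressed resolvent `r = γ Q γ` with `γ G γ` is `r ρ r` up to a small
error, if `ρ` is the compressed twisted commutator of `G` with `D`. -/
theorem IsTwistedResolvent.norm_commutator_le (hQ : IsTwistedResolvent D γ μ Q) (hD : IsSymm A D)
    (hγ : IsAdjointPair A γ γ) (hμ : μ ≠ 0) {G ρ : Y →L[ℂ] Y}
    (hG : ∀ x y, (x, y) ∈ D.graph → (G (γ (γ x)), γ (γ (G y)) + γ (ρ (γ x))) ∈ D.graph) (u : Y) :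
    ‖γ (G (γ (γ (Q (γ u))))) - γ (Q (γ (γ (G (γ u))))) - γ (Q (γ (ρ (γ (Q (γ u))))))‖ ≤
      2 * ‖G‖ * ‖γ‖ * (|μ| ^ 3)⁻¹ * ‖u‖ := by
  have hm : 0 < |μ| := abs_pos.2 hμ
  set x := Q (γ u) with hx
  set c : ℂ := I * (((μ ^ 3)⁻¹ : ℝ) : ℂ) with hc
  have hcn : ‖c‖ = (|μ| ^ 3)⁻¹ := by
    rw [hc, norm_mul, Complex.norm_I, one_mul, Complex.norm_real, Real.norm_eq_abs, abs_inv, abs_pow]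
  have h1 := hQ.left_inv _ _ (hG _ _ (hQ.mem_graph (γ u)))
  rw [← hx] at h1
  have h2 : γ (γ (G (γ u - I • twist γ μ x))) + γ (ρ (γ x)) + I • twist γ μ (G (γ (γ x))) =
      γ (γ (G (γ u))) + γ (ρ (γ x)) + c • (G (γ (γ x)) - γ (γ (G x))) := by
    simp only [twist_apply, map_sub, map_smul, map_add, hc]
    module
  rw [h2] at h1
  have h3 : γ (G (γ (γ x))) - γ (Q (γ (γ (G (γ u))))) - γ (Q (γ (ρ (γ x)))) =
      c • γ (Q (G (γ (γ x)))) - c • γ (Q (γ (γ (G x)))) := by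
    conv_lhs => enter [1, 1]; rw [← h1]
    simp only [map_add, map_smul, map_sub]
    module
  have hγx : ‖γ x‖ ≤ |μ|⁻¹ * ‖u‖ := hQ.norm_mid_le hD hγ hμ u
  have hxn : ‖x‖ ≤ |μ| * ‖u‖ := hQ.norm_right_le hD hγ hμ u
  have h4 : ‖γ (Q (G (γ (γ x))))‖ ≤ ‖G‖ * ‖γ‖ * ‖u‖ := by
    calc _ ≤ |μ| * ‖G (γ (γ x))‖ := hQ.norm_left_le hD hγ hμ _
      _ ≤ |μ| * (‖G‖ * (‖γ‖ * (|μ|⁻¹ * ‖u‖))) := by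
        gcongr
        exact (G.le_opNorm _).trans (by gcongr; exact (γ.le_opNorm _).trans (by gcongr))
      _ = _ := by field_simp
  have h5 : ‖γ (Q (γ (γ (G x))))‖ ≤ ‖G‖ * ‖γ‖ * ‖u‖ := by
    calc _ ≤ |μ|⁻¹ * ‖γ (G x)‖ := hQ.norm_mid_le hD hγ hμ _
      _ ≤ |μ|⁻¹ * (‖γ‖ * (‖G‖ * (|μ| * ‖u‖))) := by
        gcongr
        exact (γ.le_opNorm _).trans (by gcongr; exact (G.le_opNorm _).trans (by gcongr))
      _ = _ := by field_simp
  rw [h3, ← smul_sub, norm_smul, hcn]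
  calc _ ≤ (|μ| ^ 3)⁻¹ * (‖G‖ * ‖γ‖ * ‖u‖ + ‖G‖ * ‖γ‖ * ‖u‖) := by
        gcongr
        exact (norm_sub_le _ _).trans (add_le_add h4 h5)
    _ = _ := by ring

/-- On vectors `γ x` with `D x = γ z`, the operator `i μ γ Q γ` tends to the identity. -/
theorem IsTwistedResolvent.norm_sub_le (hQ : IsTwistedResolvent D γ μ Q) (hD : IsSymm A D)
    (hγ : IsAdjointPair A γ γ) (hμ : μ ≠ 0) {x z : Y} (h : (x, γ z) ∈ D.graph) :
    ‖(I * μ) • γ (Q (γ (γ x))) - γ x‖ ≤ |μ|⁻¹ * ‖z‖ + (|μ| ^ 2)⁻¹ * ‖x‖ := by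
  have hm : 0 < |μ| := abs_pos.2 hμ
  have h1 := hQ.left_inv _ _ h
  have h2 : (I * μ) • γ (Q (γ (γ x))) - γ x =
      -(γ (Q (γ z)) + (I * (((μ ^ 3)⁻¹ : ℝ) : ℂ)) • γ (Q x)) := by
    conv_lhs => enter [2]; rw [← h1]
    simp only [twist_apply, map_add, map_smul]
    module
  rw [h2, norm_neg]
  refine (norm_add_le _ _).trans (add_le_add (hQ.norm_mid_le hD hγ hμ z) ?_)
  rw [norm_smul, norm_mul, Complex.norm_I, one_mul, Complex.norm_real, Real.norm_eq_abs, abs_inv,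
    abs_pow]
  calc _ ≤ (|μ| ^ 3)⁻¹ * (|μ| * ‖x‖) := by gcongr; exact hQ.norm_left_le hD hγ hμ x
    _ = _ := by field_simp

/-- The twisted resolvent exists: if `γ²` lies between `0` and `2κ`, then `D + i (μ γ² + μ⁻³)` is a
perturbation of `D + i (μ κ + μ⁻³)` of norm at most `|μ| κ`, so a Neumann series applies. -/
theorem exists_isTwistedResolvent [CompleteSpace Y] (hsa : IsSelfAdjoint A D)
    (hr : IsRegular A D) (hγ : IsAdjointPair A γ γ) {κ : ℝ} (hκ : 0 ≤ κ)
    (hκγ : ‖γ * γ - (κ : ℂ) • 1‖ ≤ κ) (hμ : μ ≠ 0) :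
    ∃ Q : Y →L[ℂ] Y, IsTwistedResolvent D γ μ Q := by
  have hm : 0 < |μ| := abs_pos.2 hμ
  have h1 : μ * κ + (μ ^ 3)⁻¹ = μ * (κ + (μ ^ 4)⁻¹) := by field_simp
  have h4 : 0 < (μ ^ 4)⁻¹ := inv_pos.2 (by positivity)
  have h0 : μ * κ + (μ ^ 3)⁻¹ ≠ 0 := by
    rw [h1]
    exact mul_ne_zero hμ (by positivity)
  have h2 : ‖((μ : ℂ) * I) • (γ * γ - (κ : ℂ) • (1 : Y →L[ℂ] Y))‖ < |μ * κ + (μ ^ 3)⁻¹| := by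
    rw [h1, abs_mul, norm_smul, norm_mul, Complex.norm_I, mul_one, Complex.norm_real,
      Real.norm_eq_abs, abs_of_nonneg (add_nonneg hκ h4.le)]
    exact mul_lt_mul_of_pos_left (by linarith) hm
  have h3 := (hr.addSurjective hsa h0).add hsa.isSymm h2
  have he : (((μ * κ + (μ ^ 3)⁻¹ : ℝ) : ℂ) * I) • (1 : Y →L[ℂ] Y) +
      ((μ : ℂ) * I) • (γ * γ - (κ : ℂ) • (1 : Y →L[ℂ] Y)) = I • twist γ μ := by
    rw [twist]
    push_cast
    module
  rw [he] at h3
  have hm3 : 0 < (|μ| ^ 3)⁻¹ := by positivity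
  obtain ⟨Q, hQ, hQ', -⟩ := h3.exists_inverse hm3 (fun x y h => by
    have h5 := (mul_norm_sq_le hsa.isSymm hγ hμ h).2.trans
      (CStarModule.norm_inner_le (A := A) Y)
    rcases (norm_nonneg x).eq_or_lt with h0 | h0
    · rw [← h0]; simp
    · exact le_of_mul_le_mul_left (by simpa [pow_two, mul_left_comm] using h5) h0)
  exact ⟨Q, hQ, hQ'⟩

end Estimates

/-! ### Bounded selfadjoint operators -/

/-- For selfadjoint bounded `N` and `‖E‖ ≤ |λ| - 1`, the operator `N + E + iλ` is onto, and its
inverse has norm at most `1`. -/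
theorem exists_solution [CompleteSpace Y] {N E : Y →L[ℂ] Y} (hN : IsAdjointPair A N N) {C l : ℝ}
    (hE : ∀ u, ‖E u‖ ≤ C * ‖u‖) (hC : 0 ≤ C) (hl : C + 1 ≤ |l|) (v : Y) :
    ∃ y, N y + E y + (l * I : ℂ) • y = v ∧ ‖y‖ ≤ ‖v‖ := by
  let T : Y →ₗ.[ℂ] Y := (N : Y →ₗ[ℂ] Y).toPMap ⊤
  have hg : ∀ x y, (x, y) ∈ T.graph ↔ y = N x := by
    intro x y
    rw [LinearPMap.mem_graph_iff]
    constructor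
    · rintro ⟨u, rfl, rfl⟩; rfl
    · rintro rfl; exact ⟨⟨x, trivial⟩, rfl, rfl⟩
  have hT : IsSymm A T := by
    intro x y x' y' h h'
    rw [hg] at h h'
    rw [h, h']
    exact hN x x'
  have hs : AddSurjective T (((l : ℂ) * I) • (1 : Y →L[ℂ] Y)) := by
    let n : AdjointableOp A Y := ⟨N, N, hN⟩
    have hn : _root_.IsSelfAdjoint n := AdjointableOp.star_eq_of_isAdjointPair hN
    have h1 : -((l : ℂ) * I) ∉ spectrum ℂ n := by
      intro h
      have h2 := congrArg Complex.im (hn.mem_spectrum_eq_re h)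
      simp at h2
      rw [h2, abs_zero] at hl
      linarith
    rw [spectrum.notMem_iff] at h1
    obtain ⟨U, hU⟩ := h1
    intro v
    refine ⟨-((U⁻¹ : (AdjointableOp A Y)ˣ).1.toCLM v), _, (hg _ _).2 rfl, ?_⟩
    have h3 : (U : AdjointableOp A Y).toCLM ((U⁻¹ : (AdjointableOp A Y)ˣ).1.toCLM v) = v := by
      have h4 := congrArg AdjointableOp.toCLM U.mul_inv
      rw [AdjointableOp.toCLM_mul] at h4
      exact DFunLike.congr_fun h4 v
    rw [hU] at h3
    have h5 : ∀ w, (algebraMap ℂ (AdjointableOp A Y) (-((l : ℂ) * I)) - n).toCLM w =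
        (-((l : ℂ) * I)) • w - N w := fun w => rfl
    rw [h5] at h3
    conv_rhs => rw [← h3]
    simp
    abel
  have hEn : ‖E‖ < |l| := (E.opNorm_le_bound hC hE).trans_lt (by linarith)
  obtain ⟨y, z, hz, hy⟩ := hs.add hT hEn v
  rw [hg] at hz
  subst hz
  simp only [add_apply, smul_apply, one_apply_eq_self] at hy
  refine ⟨y, by rw [← hy]; abel, ?_⟩
  have h1 := hT.norm_le l ((hg y _).2 rfl)
  have h2 : N y + ((l : ℂ) * I) • y = v - E y := by rw [← hy]; abel
  rw [h2] at h1
  have h3 := h1.trans ((norm_sub_le v (E y)).trans (add_le_add_right (hE y) _))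
  nlinarith [norm_nonneg y, mul_le_mul_of_nonneg_right hl (norm_nonneg y)]

/-! ### Approximate solutions -/

/-- The operator `P = (iμ/2) (γ Q γ - γ Q' γ)`, for the resolvents `Q` and `Q'` at `μ` and `-μ`.
Formally it is `μ² (μ² + S²)⁻¹` for `S = γ⁻¹ D γ⁻¹`. -/
def cutoff (γ Q Q' : Y →L[ℂ] Y) (μ : ℝ) : Y →L[ℂ] Y :=
  (I * μ / 2 : ℂ) • (γ * (Q - Q') * γ)

/-- The operator `(μ²/2) (γ Q γ + γ Q' γ)`, for the resolvents `Q` and `Q'` at `μ` and `-μ`.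
Formally it is `μ² S (μ² + S²)⁻¹` for `S = γ⁻¹ D γ⁻¹`, a bounded approximation of `S`. -/
def boundedApprox (γ Q Q' : Y →L[ℂ] Y) (μ : ℝ) : Y →L[ℂ] Y :=
  (μ ^ 2 / 2 : ℂ) • (γ * (Q + Q') * γ)

theorem cutoff_apply (γ Q Q' : Y →L[ℂ] Y) (μ : ℝ) (u : Y) :
    cutoff γ Q Q' μ u = (I * μ / 2 : ℂ) • (γ (Q (γ u)) - γ (Q' (γ u))) := by
  simp [cutoff]

theorem boundedApprox_apply (γ Q Q' : Y →L[ℂ] Y) (μ : ℝ) (u : Y) :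
    boundedApprox γ Q Q' μ u = (μ ^ 2 / 2 : ℂ) • (γ (Q (γ u)) + γ (Q' (γ u))) := by
  simp [boundedApprox]

section Approx

variable {D : Y →ₗ.[ℂ] Y} {γ Q Q' : Y →L[ℂ] Y} {μ : ℝ}

theorem isAdjointPair_cutoff (hD : IsSymm A D) (hγ : IsAdjointPair A γ γ)
    (hQ : IsTwistedResolvent D γ μ Q) (hQ' : IsTwistedResolvent D γ (-μ) Q') :
    IsAdjointPair A (cutoff γ Q Q' μ) (cutoff γ Q Q' μ) := fun x y => by
  have h1 := hQ.isAdjointPair hQ' hD hγ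
  simp only [cutoff_apply, CStarModule.inner_smul_left_complex,
    CStarModule.inner_smul_right_complex, CStarModule.inner_sub_left,
    CStarModule.inner_sub_right, hγ _ _, h1 _ _, h1.symm A _ _]
  simp
  module

theorem isAdjointPair_boundedApprox (hD : IsSymm A D) (hγ : IsAdjointPair A γ γ)
    (hQ : IsTwistedResolvent D γ μ Q) (hQ' : IsTwistedResolvent D γ (-μ) Q') :
    IsAdjointPair A (boundedApprox γ Q Q' μ) (boundedApprox γ Q Q' μ) := fun x y => by
  have h1 := hQ.isAdjointPair hQ' hD hγ
  simp only [boundedApprox_apply, CStarModule.inner_smul_left_complex,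
    CStarModule.inner_smul_right_complex, CStarModule.inner_add_left,
    CStarModule.inner_add_right, hγ _ _, h1 _ _, h1.symm A _ _]
  simp
  module

theorem norm_cutoff_le (hD : IsSymm A D) (hγ : IsAdjointPair A γ γ) (hμ : 0 < μ)
    (hQ : IsTwistedResolvent D γ μ Q) (hQ' : IsTwistedResolvent D γ (-μ) Q') (u : Y) :
    ‖cutoff γ Q Q' μ u‖ ≤ ‖u‖ := by
  have h1 := hQ.norm_mid_le hD hγ hμ.ne' u
  have h2 := hQ'.norm_mid_le hD hγ (neg_ne_zero.2 hμ.ne') u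
  rw [abs_neg] at h2
  rw [abs_of_pos hμ] at h1 h2
  rw [cutoff_apply, norm_smul]
  have h3 : ‖(I * μ / 2 : ℂ)‖ = μ / 2 := by simp [abs_of_pos hμ]
  rw [h3]
  calc _ ≤ μ / 2 * (μ⁻¹ * ‖u‖ + μ⁻¹ * ‖u‖) := by
        gcongr
        exact (norm_sub_le _ _).trans (add_le_add h1 h2)
    _ = _ := by field_simp; ring

theorem norm_cutoff_sub_le (hD : IsSymm A D) (hγ : IsAdjointPair A γ γ) (hμ : 0 < μ)
    (hQ : IsTwistedResolvent D γ μ Q) (hQ' : IsTwistedResolvent D γ (-μ) Q') {x z : Y}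
    (h : (x, γ z) ∈ D.graph) :
    ‖cutoff γ Q Q' μ (γ x) - γ x‖ ≤ μ⁻¹ * ‖z‖ + (μ ^ 2)⁻¹ * ‖x‖ := by
  have h1 := hQ.norm_sub_le hD hγ hμ.ne' h
  have h2 := hQ'.norm_sub_le hD hγ (neg_ne_zero.2 hμ.ne') h
  rw [abs_neg] at h2
  rw [abs_of_pos hμ] at h1 h2
  have h3 : cutoff γ Q Q' μ (γ x) - γ x =
      (1 / 2 : ℂ) • (((I * μ) • γ (Q (γ (γ x))) - γ x) +
        ((I * (-μ : ℝ)) • γ (Q' (γ (γ x))) - γ x)) := by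
    rw [cutoff_apply]
    push_cast
    module
  rw [h3, norm_smul]
  calc _ ≤ ‖(1 / 2 : ℂ)‖ * (_ + _) := by
        gcongr
        exact (norm_add_le _ _).trans (add_le_add h1 h2)
    _ = _ := by
        simp
        ring

theorem norm_commutator_boundedApprox_le (hD : IsSymm A D) (hγ : IsAdjointPair A γ γ)
    (hμ : 1 ≤ μ) (hQ : IsTwistedResolvent D γ μ Q) (hQ' : IsTwistedResolvent D γ (-μ) Q')
    {G ρ : Y →L[ℂ] Y}
    (hG : ∀ x y, (x, y) ∈ D.graph → (G (γ (γ x)), γ (γ (G y)) + γ (ρ (γ x))) ∈ D.graph) (u : Y) :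
    ‖γ (G (γ (boundedApprox γ Q Q' μ u))) - boundedApprox γ Q Q' μ (γ (G (γ u)))‖ ≤
      (‖ρ‖ + 2 * ‖G‖ * ‖γ‖) * ‖u‖ := by
  have h0 : 0 < μ := by linarith
  have aux : ∀ (ν : ℝ) (R : Y →L[ℂ] Y), |ν| = μ → IsTwistedResolvent D γ ν R →
      ‖γ (G (γ (γ (R (γ u))))) - γ (R (γ (γ (G (γ u)))))‖ ≤
        (μ ^ 2)⁻¹ * ((‖ρ‖ + 2 * ‖G‖ * ‖γ‖) * ‖u‖) := by
    intro ν R hν hR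
    have hν0 : ν ≠ 0 := abs_pos.1 (hν ▸ h0)
    have h1 := hR.norm_commutator_le hD hγ hν0 hG u
    have h2 : ‖γ (R (γ (ρ (γ (R (γ u))))))‖ ≤ μ⁻¹ * (‖ρ‖ * (μ⁻¹ * ‖u‖)) := by
      calc _ ≤ |ν|⁻¹ * ‖ρ (γ (R (γ u)))‖ := hR.norm_mid_le hD hγ hν0 _
        _ ≤ |ν|⁻¹ * (‖ρ‖ * (|ν|⁻¹ * ‖u‖)) := by
          gcongr
          exact (ρ.le_opNorm _).trans (by gcongr; exact hR.norm_mid_le hD hγ hν0 _)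
        _ = _ := by rw [hν]
    rw [hν] at h1
    have h3 : (μ ^ 3)⁻¹ ≤ (μ ^ 2)⁻¹ :=
      inv_anti₀ (by positivity) (pow_le_pow_right₀ hμ (by norm_num))
    calc _ = ‖(γ (G (γ (γ (R (γ u))))) - γ (R (γ (γ (G (γ u))))) - γ (R (γ (ρ (γ (R (γ u)))))))
            + γ (R (γ (ρ (γ (R (γ u))))))‖ := by rw [sub_add_cancel]
      _ ≤ 2 * ‖G‖ * ‖γ‖ * (μ ^ 3)⁻¹ * ‖u‖ + μ⁻¹ * (‖ρ‖ * (μ⁻¹ * ‖u‖)) :=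
        (norm_add_le _ _).trans (add_le_add h1 h2)
      _ ≤ 2 * ‖G‖ * ‖γ‖ * (μ ^ 2)⁻¹ * ‖u‖ + μ⁻¹ * (‖ρ‖ * (μ⁻¹ * ‖u‖)) := by gcongr
      _ = _ := by
        have : (μ ^ 2)⁻¹ = μ⁻¹ * μ⁻¹ := by rw [pow_two, mul_inv]
        rw [this]; ring
  have h1 := aux μ Q (abs_of_pos h0) hQ
  have h2 := aux (-μ) Q' (by rw [abs_neg, abs_of_pos h0]) hQ'
  have h3 : γ (G (γ (boundedApprox γ Q Q' μ u))) - boundedApprox γ Q Q' μ (γ (G (γ u))) =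
      (μ ^ 2 / 2 : ℂ) • ((γ (G (γ (γ (Q (γ u))))) - γ (Q (γ (γ (G (γ u)))))) +
        (γ (G (γ (γ (Q' (γ u))))) - γ (Q' (γ (γ (G (γ u))))))) := by
    simp only [boundedApprox_apply, map_smul, map_add]
    module
  have h4 : ‖(μ ^ 2 / 2 : ℂ)‖ = μ ^ 2 / 2 := by simp [abs_of_pos h0]
  rw [h3, norm_smul, h4]
  calc _ ≤ μ ^ 2 / 2 * (_ + _) := by
        gcongr
        exact (norm_add_le _ _).trans (add_le_add h1 h2)
    _ = _ := by field_simp; ring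

/-- Vectors `x` with `(γ G D + ρ γ + iλ γ) x = v + iλ (P - 1) y + O(μ⁻¹)` and `‖y‖ ≤ ‖v‖`,
where `P` is the cutoff. -/
theorem exists_approx_solution [CompleteSpace Y] (hD : IsSymm A D) (hγ : IsAdjointPair A γ γ)
    (hμ : 1 ≤ μ) (hQ : IsTwistedResolvent D γ μ Q) (hQ' : IsTwistedResolvent D γ (-μ) Q')
    {G ρ : Y →L[ℂ] Y} (hGG : IsAdjointPair A G G)
    (hG : ∀ x y, (x, y) ∈ D.graph → (G (γ (γ x)), γ (γ (G y)) + γ (ρ (γ x))) ∈ D.graph)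
    {l : ℝ} (hl : 2 * ‖ρ‖ + 2 * ‖G‖ * ‖γ‖ + 1 ≤ |l|) (v : Y) :
    ∃ y x z, ‖y‖ ≤ ‖v‖ ∧ (x, z) ∈ D.graph ∧
      ‖γ (G z) + ρ (γ x) + (l * I : ℂ) • γ x -
        (v + (l * I : ℂ) • (cutoff γ Q Q' μ y - y))‖ ≤ μ⁻¹ * (‖γ‖ * ‖G‖ * ‖v‖) := by
  have h0 : 0 < μ := by linarith
  let S := boundedApprox γ Q Q' μ
  let P := cutoff γ Q Q' μ
  let H := γ * G * γ
  have hS : IsAdjointPair A S S := isAdjointPair_boundedApprox hD hγ hQ hQ'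
  have hH : IsAdjointPair A H H := fun u w => by simp [H, hγ _ _, hGG _ _]
  -- `H S + ρ P` is the selfadjoint `(H S + S H) / 2` plus a uniformly bounded operator
  have hN : IsAdjointPair A ((1 / 2 : ℂ) • (H * S + S * H)) ((1 / 2 : ℂ) • (H * S + S * H)) :=
    fun u w => by simp [hS _ _, hH _ _, add_comm]
  have hE : ∀ u, ‖((1 / 2 : ℂ) • (H * S - S * H) + ρ * P) u‖ ≤
      (2 * ‖ρ‖ + 2 * ‖G‖ * ‖γ‖) * ‖u‖ := by
    intro u
    have h1 : ‖H (S u) - S (H u)‖ ≤ _ := norm_commutator_boundedApprox_le hD hγ hμ hQ hQ' hG u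
    have h2 : ‖ρ (P u)‖ ≤ ‖ρ‖ * ‖u‖ :=
      (ρ.le_opNorm _).trans (by gcongr; exact norm_cutoff_le hD hγ h0 hQ hQ' u)
    calc _ = ‖(1 / 2 : ℂ) • (H (S u) - S (H u)) + ρ (P u)‖ := rfl
      _ ≤ ‖(1 / 2 : ℂ)‖ * ((‖ρ‖ + 2 * ‖G‖ * ‖γ‖) * ‖u‖) + ‖ρ‖ * ‖u‖ := by
        refine (norm_add_le _ _).trans (add_le_add ?_ h2)
        rw [norm_smul]
        gcongr
      _ ≤ _ := by
        have h3 : 0 ≤ ‖G‖ * ‖γ‖ * ‖u‖ := by positivity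
        have h4 : 0 ≤ ‖ρ‖ * ‖u‖ := by positivity
        simp
        nlinarith
  obtain ⟨y, hy, hyv⟩ := exists_solution hN hE (by positivity) hl v
  have hy' : H (S y) + ρ (P y) + (l * I : ℂ) • y = v := by
    rw [← hy]
    simp only [add_apply, smul_apply, sub_apply, mul_apply_eq_comp]
    module
  have hmem := D.graph.smul_mem (I * μ / 2 : ℂ)
    (D.graph.sub_mem (hQ.mem_graph (γ y)) (hQ'.mem_graph (γ y)))
  rw [Prod.mk_sub_mk, Prod.smul_mk] at hmem
  refine ⟨y, _, _, hyv, hmem, ?_⟩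
  have hγx : γ ((I * μ / 2 : ℂ) • (Q (γ y) - Q' (γ y))) = P y := by
    simp [P, cutoff_apply]
  have hc : (μ : ℂ) * (((μ ^ 3)⁻¹ : ℝ) : ℂ) = (((μ ^ 2)⁻¹ : ℝ) : ℂ) := by
    rw [← Complex.ofReal_mul]
    congr 1
    field_simp
  have hz : (I * μ / 2 : ℂ) • (γ y - I • twist γ μ (Q (γ y)) -
      (γ y - I • twist γ (-μ) (Q' (γ y)))) =
      γ (S y) + ((((μ ^ 2)⁻¹ : ℝ) : ℂ) / 2) • (Q (γ y) + Q' (γ y)) := by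
    have h1 : (I * μ / 2 : ℂ) • (γ y - I • twist γ μ (Q (γ y)) -
        (γ y - I • twist γ (-μ) (Q' (γ y)))) =
        (-(I * I) * μ / 2 : ℂ) • twist γ μ (Q (γ y) + Q' (γ y)) := by
      rw [twist_neg, map_add]
      module
    rw [h1, I_mul_I, twist_apply, ← hc]
    simp only [S, boundedApprox_apply, map_smul, map_add]
    module
  rw [hγx, hz]
  have he : γ (G (γ (S y) + ((((μ ^ 2)⁻¹ : ℝ) : ℂ) / 2) • (Q (γ y) + Q' (γ y)))) + ρ (P y) +
      (l * I : ℂ) • P y - (v + (l * I : ℂ) • (P y - y)) =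
      ((((μ ^ 2)⁻¹ : ℝ) : ℂ) / 2) • γ (G (Q (γ y) + Q' (γ y))) := by
    rw [← hy']
    simp only [map_add, map_smul, H, mul_apply_eq_comp]
    module
  have h1 := hQ.norm_right_le hD hγ h0.ne' y
  have h2 := hQ'.norm_right_le hD hγ (neg_ne_zero.2 h0.ne') y
  rw [abs_neg] at h2
  rw [abs_of_pos h0] at h1 h2
  have h3 : ‖((((μ ^ 2)⁻¹ : ℝ) : ℂ) / 2)‖ = (μ ^ 2)⁻¹ / 2 := by
    simp
  have h4 : ‖γ (G (Q (γ y) + Q' (γ y)))‖ ≤ ‖γ‖ * (‖G‖ * (μ * ‖v‖ + μ * ‖v‖)) := by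
    refine (γ.le_opNorm _).trans ?_
    gcongr
    refine (G.le_opNorm _).trans ?_
    gcongr
    exact (norm_add_le _ _).trans (add_le_add (h1.trans (by gcongr)) (h2.trans (by gcongr)))
  change ‖γ (G (γ (S y) + ((((μ ^ 2)⁻¹ : ℝ) : ℂ) / 2) • (Q (γ y) + Q' (γ y)))) + ρ (P y) +
      (l * I : ℂ) • P y - (v + (l * I : ℂ) • (P y - y))‖ ≤ _
  rw [he, norm_smul, h3]
  calc _ ≤ (μ ^ 2)⁻¹ / 2 * (‖γ‖ * (‖G‖ * (μ * ‖v‖ + μ * ‖v‖))) := by gcongr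
    _ = _ := by field_simp; ring

end Approx

theorem mem_sandwich_graph {S : Y →L[ℂ] X} {D : Y →ₗ.[ℂ] Y} {T : X →L[ℂ] Y} {x : X} {z : Y}
    (h : (T x, z) ∈ D.graph) : (x, S z) ∈ (sandwich S D T).graph := by
  obtain ⟨u, hu, rfl⟩ := (LinearPMap.mem_graph_iff _).1 h
  have hx : T x ∈ D.domain := by
    have := u.2
    rwa [hu] at this
  have hu' : u = ⟨T x, hx⟩ := Subtype.ext hu
  subst hu'
  exact (sandwich S D T).mem_graph ⟨x, hx⟩

theorem exists_of_mem_sandwich_graph {S : Y →L[ℂ] X} {D : Y →ₗ.[ℂ] Y} {T : X →L[ℂ] Y} {x x' : X}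
    (h : (x, x') ∈ (sandwich S D T).graph) : ∃ z, (T x, z) ∈ D.graph ∧ S z = x' := by
  obtain ⟨u, rfl, rfl⟩ := (LinearPMap.mem_graph_iff _).1 h
  exact ⟨_, D.mem_graph ⟨T u, u.2⟩, rfl⟩

theorem IsSymm.sandwich {D : Y →ₗ.[ℂ] Y} (hD : IsSymm A D) {Φ : X →L[ℂ] Y} {Φs : Y →L[ℂ] X}
    (hΦ : IsAdjointPair A Φ Φs) : IsSymm A (sandwich Φs D Φ) := by
  intro x y x' y' h h'
  obtain ⟨z, hz, rfl⟩ := exists_of_mem_sandwich_graph h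
  obtain ⟨z', hz', rfl⟩ := exists_of_mem_sandwich_graph h'
  rw [hΦ.symm A, hD hz hz', hΦ]

/-- Uniformly bounded operators that converge strongly on a set converge on its closure. -/
theorem tendsto_of_mem_closure {u : ℕ → Y →L[ℂ] Y} (hu : ∀ n y, ‖u n y‖ ≤ ‖y‖) {s : Set Y}
    (hs : ∀ y ∈ s, Tendsto (fun n => u n y) atTop (𝓝 y)) {y : Y} (hy : y ∈ closure s) :
    Tendsto (fun n => u n y) atTop (𝓝 y) := by
  rw [Metric.tendsto_atTop]
  intro ε hε
  obtain ⟨w, hw, hyw⟩ := Metric.mem_closure_iff.1 hy (ε / 3) (by positivity)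
  obtain ⟨N, hN⟩ := Metric.tendsto_atTop.1 (hs w hw) (ε / 3) (by positivity)
  refine ⟨N, fun n hn => ?_⟩
  have h1 := hN n hn
  rw [dist_eq_norm] at h1 hyw ⊢
  have h2 : ‖u n (y - w)‖ ≤ ‖y - w‖ := hu n _
  have h3 : u n y - y = u n (y - w) + (u n w - w) - (y - w) := by rw [map_sub]; abel
  rw [h3]
  calc _ ≤ ‖u n (y - w)‖ + ‖u n w - w‖ + ‖y - w‖ :=
        (norm_sub_le _ _).trans (add_le_add_left (norm_add_le _ _) _)
    _ < ε := by linarith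

/-! ### The modular lift -/

section ModularLift

variable [CompleteSpace Y] {D : Y →ₗ.[ℂ] Y} {γ ρ : Y →L[ℂ] Y} {Q : ℝ → Y →L[ℂ] Y}
  {Φ : X →L[ℂ] Y} {Φs : Y →L[ℂ] X}

/-- The domain of `Φ* D Φ` contains `Φ* γ² 𝓓(D)`, which is dense. -/
theorem dense_image_domain (hd : Dense (D.domain : Set Y)) (hγd : DenseRange γ)
    (hΦd : DenseRange Φs) : Dense {x : X | ∃ y z, (y, z) ∈ D.graph ∧ Φs (γ (γ y)) = x} := by
  have h1 : DenseRange (Φs ∘ γ ∘ γ) :=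
    hΦd.comp (hγd.comp hγd γ.continuous) Φs.continuous
  refine (h1.dense_image (by fun_prop) hd).mono ?_
  rintro _ ⟨y, hy, rfl⟩
  exact ⟨y, _, D.mem_graph ⟨y, hy⟩, rfl⟩

theorem dense_range_sandwich_add (hD : IsSymm A D) (hd : Dense (D.domain : Set Y))
    (hγ : IsAdjointPair A γ γ) (hγd : DenseRange γ)
    (hΦ : IsAdjointPair A Φ Φs) (hΦd : DenseRange Φs)
    (hQ : ∀ μ ≠ 0, IsTwistedResolvent D γ μ (Q μ))
    (hG : ∀ x y, (x, y) ∈ D.graph →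
      (Φ (Φs (γ (γ x))), γ (γ (Φ (Φs y))) + γ (ρ (γ x))) ∈ D.graph)
    {l : ℝ} (hl : 2 * ‖ρ‖ + 2 * ‖Φ ∘L Φs‖ * ‖γ‖ + 1 ≤ |l|) :
    Dense {v : X | ∃ x y, (x, y) ∈ (sandwich Φs D Φ).graph ∧ y + ((l : ℂ) * I) • x = v} := by
  have hGG : IsAdjointPair A (Φ ∘L Φs) (Φ ∘L Φs) := fun u w => by
    simp [hΦ _ _, hΦ.symm A _ _]
  let S : Submodule ℂ X :=
    (sandwich Φs D Φ).graph.map (LinearMap.snd ℂ X X + ((l : ℂ) * I) • LinearMap.fst ℂ X X)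
  have hSet : {v : X | ∃ x y, (x, y) ∈ (sandwich Φs D Φ).graph ∧ y + ((l : ℂ) * I) • x = v} =
      (S : Set X) := by
    ext v
    constructor
    · rintro ⟨x, y, h, rfl⟩
      exact ⟨(x, y), h, rfl⟩
    · rintro ⟨⟨x, y⟩, h, rfl⟩
      exact ⟨x, y, h, rfl⟩
  rw [hSet]
  -- it suffices to approximate the vectors `Φ* γ v`
  have hsuff : ∀ v, Φs (γ v) ∈ closure (S : Set X) := by
    intro v
    let μ : ℕ → ℝ := fun n => n + 1
    have hμ : ∀ n, 1 ≤ μ n := fun n => by simp [μ]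
    have hμ0 : ∀ n, 0 < μ n := fun n => by linarith [hμ n]
    have hμlim : Tendsto (fun n => (μ n)⁻¹) atTop (𝓝 0) := by
      simpa [μ] using tendsto_one_div_add_atTop_nhds_zero_nat (𝕜 := ℝ)
    have hp := fun n => hQ (μ n) (hμ0 n).ne'
    have hm := fun n => hQ (-μ n) (neg_ne_zero.2 (hμ0 n).ne')
    choose y x z hy hxz he using fun n =>
      exists_approx_solution hD hγ (hμ n) (hp n) (hm n) hGG hG hl v
    let P : ℕ → Y →L[ℂ] Y := fun n => cutoff γ (Q (μ n)) (Q (-μ n)) (μ n)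
    have hPn : ∀ n u, ‖P n u‖ ≤ ‖u‖ := fun n u => norm_cutoff_le hD hγ (hμ0 n) (hp n) (hm n) u
    let c : ℂ := (l : ℂ) * I
    let e : ℕ → Y := fun n => γ (Φ (Φs (z n))) + ρ (γ (x n)) + c • γ (x n) -
        (v + c • (P n (y n) - y n))
    have he' : ∀ n, ‖e n‖ ≤ (μ n)⁻¹ * (‖γ‖ * ‖Φ ∘L Φs‖ * ‖v‖) := he
    have hP : ∀ w : X, Tendsto (fun n => P n (γ (Φ w))) atTop (𝓝 (γ (Φ w))) := by
      intro w
      refine tendsto_of_mem_closure hPn (s := {u | ∃ a b, (a, γ b) ∈ D.graph ∧ γ a = u}) ?_ ?_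
      · rintro _ ⟨a, b, hab, rfl⟩
        rw [tendsto_iff_norm_sub_tendsto_zero]
        have h1 : Tendsto (fun n => (μ n)⁻¹ * ‖b‖ + ((μ n) ^ 2)⁻¹ * ‖a‖) atTop (𝓝 0) := by
          have := (hμlim.mul_const ‖b‖).add ((hμlim.pow 2).mul_const ‖a‖)
          simpa using this
        exact squeeze_zero (fun _ => norm_nonneg _)
          (fun n => norm_cutoff_sub_le hD hγ (hμ0 n) (hp n) (hm n) hab) h1
      · refine map_mem_closure (f := fun x => γ (Φ x)) (by fun_prop)
          (dense_image_domain hd hγd hΦd w) ?_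
        rintro _ ⟨a, b, hab, rfl⟩
        refine ⟨_, γ (Φ (Φs b)) + ρ (γ a), ?_, rfl⟩
        rw [map_add]
        exact hG a b hab
    refine mem_closure_of_weak_limit A S (b := fun n => Φs (γ (c • (P n (y n) - y n) + e n)))
      (M := ‖Φs‖ * (‖γ‖ * (‖c‖ * (‖v‖ + ‖v‖) + 1 * (‖γ‖ * ‖Φ ∘L Φs‖ * ‖v‖)))) ?_ ?_ ?_
    · intro n
      refine (Φs.le_opNorm _).trans ?_
      gcongr
      refine (γ.le_opNorm _).trans ?_
      gcongr
      refine (norm_add_le _ _).trans (add_le_add ?_ ((he' n).trans ?_))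
      · rw [norm_smul]
        gcongr
        exact (norm_sub_le _ _).trans (add_le_add ((hPn n _).trans (hy n)) (hy n))
      · gcongr
        exact inv_le_one_of_one_le₀ (hμ n)
    · intro w
      rw [tendsto_zero_iff_norm_tendsto_zero]
      have h1 : Tendsto (fun n => ‖c‖ * (‖P n (γ (Φ w)) - γ (Φ w)‖ * ‖v‖) +
          ‖γ (Φ w)‖ * ((μ n)⁻¹ * (‖γ‖ * ‖Φ ∘L Φs‖ * ‖v‖))) atTop (𝓝 0) := by
        have h2 := tendsto_iff_norm_sub_tendsto_zero.1 (hP w)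
        have := ((h2.mul_const ‖v‖).const_mul ‖c‖).add
          ((hμlim.mul_const (‖γ‖ * ‖Φ ∘L Φs‖ * ‖v‖)).const_mul ‖γ (Φ w)‖)
        simpa using this
      refine squeeze_zero (fun _ => norm_nonneg _) (fun n => ?_) h1
      have hPa : IsAdjointPair A (P n) (P n) := isAdjointPair_cutoff hD hγ (hp n) (hm n)
      have h2 : inner A w (Φs (γ (c • (P n (y n) - y n) + e n))) =
          c • inner A (P n (γ (Φ w)) - γ (Φ w)) (y n) + inner A (γ (Φ w)) (e n) := by
        rw [← hΦ, ← hγ, CStarModule.inner_add_right, CStarModule.inner_smul_right_complex,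
          CStarModule.inner_sub_right, CStarModule.inner_sub_left, hPa]
      rw [h2]
      refine (norm_add_le _ _).trans (add_le_add ?_ ?_)
      · rw [norm_smul]
        gcongr
        exact (CStarModule.norm_inner_le (A := A) Y).trans (by gcongr; exact hy n)
      · exact (CStarModule.norm_inner_le (A := A) Y).trans (by gcongr; exact he' n)
    · intro n
      refine Submodule.mem_map.2 ⟨_, mem_sandwich_graph (hG _ _ (hxz n)), ?_⟩
      simp only [e, LinearMap.add_apply, LinearMap.smul_apply, LinearMap.snd_apply,
        LinearMap.fst_apply]
      rw [← map_add Φs, ← map_add γ (γ (Φ (Φs (z n)))), ← map_smul, ← map_smul, ← map_add Φs,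
        ← map_add γ, ← map_add γ]
      congr 2
      abel
  have h1 : DenseRange (Φs ∘ γ) := hΦd.comp hγd Φs.continuous
  have h2 : Dense (closure (S : Set X)) := h1.mono (by rintro _ ⟨v, rfl⟩; exact hsuff v)
  exact dense_closure.1 h2

end ModularLift

end

end HilbertCStar

open HilbertCStar in
theorem theoremt {A : Type*} [NonUnitalCStarAlgebra A] [PartialOrder A] [StarOrderedRing A]
    {X : Type*} [NormedAddCommGroup X] [NormedSpace ℂ X] [SMul A X] [CStarModule A X]
    [CompleteSpace X]
    {Y : Type*} [NormedAddCommGroup Y] [NormedSpace ℂ Y] [SMul A Y] [CStarModule A Y]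
    [CompleteSpace Y]
    (D : Y →ₗ.[ℂ] Y)
    (hD_selfadjoint : HilbertCStar.IsSelfAdjoint A D) (hD_regular : HilbertCStar.IsRegular A D)
    (Γ : HilbertCStar.AdjointableOp A Y) (hΓ_nonneg : 0 ≤ Γ)
    (hΓ_dense : DenseRange Γ.toCLM)
    (Φ : X →L[ℂ] Y) (Φs : Y →L[ℂ] X) (hΦ_adjoint : HilbertCStar.IsAdjointPair A Φ Φs)
    (hΦ_dense : DenseRange Φs)
    (hG : HilbertCStar.IsDifferentiable A D Γ (Φ ∘L Φs)) :
    (HilbertCStar.sandwich Φs D Φ).IsClosable ∧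
      HilbertCStar.IsSelfAdjoint A (HilbertCStar.modularLift Φs D Φ) ∧
      HilbertCStar.IsRegular A (HilbertCStar.modularLift Φs D Φ) := by
  have hD := hD_selfadjoint.isSymm
  set γ : Y →L[ℂ] Y := (CFC.sqrt Γ).toCLM with hγ_def
  have hΓ : Γ.toCLM = γ * γ := by
    rw [hγ_def, ← AdjointableOp.toCLM_mul, CFC.sqrt_mul_sqrt_self Γ hΓ_nonneg]
  have hγ : IsAdjointPair A γ γ := by
    have := AdjointableOp.isAdjointPair_star (CFC.sqrt Γ)
    rwa [(CFC.sqrt_nonneg Γ).star_eq] at this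
  have hγd : DenseRange γ := by
    rw [hΓ] at hΓ_dense
    refine hΓ_dense.mono ?_
    rintro _ ⟨y, rfl⟩
    exact ⟨γ y, rfl⟩
  -- `0 ≤ ‖Γ‖ - Γ ≤ ‖Γ‖`
  have hκ : ‖γ * γ - ((‖Γ‖ : ℝ) : ℂ) • 1‖ ≤ ‖Γ‖ := by
    have h1 : algebraMap ℝ (AdjointableOp A Y) ‖Γ‖ - Γ ∈
        Set.Icc 0 (algebraMap ℝ (AdjointableOp A Y) ‖Γ‖) :=
      ⟨sub_nonneg.2 (IsSelfAdjoint.of_nonneg hΓ_nonneg).le_algebraMap_norm_self,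
        sub_le_self _ hΓ_nonneg⟩
    have h2 := ((CStarAlgebra.mem_Icc_algebraMap_iff_norm_le (norm_nonneg Γ)).1 h1).2
    rw [← AdjointableOp.norm_toCLM] at h2
    have h3 : (algebraMap ℝ (AdjointableOp A Y) ‖Γ‖ - Γ).toCLM =
        ((‖Γ‖ : ℝ) : ℂ) • 1 - γ * γ := by
      rw [← hΓ, IsScalarTower.algebraMap_apply ℝ ℂ (AdjointableOp A Y)]
      rfl
    rwa [h3, norm_sub_rev] at h2
  obtain ⟨d, hd, hdγ, ρ, hρ⟩ := hG.factorization
  have hcomm : ∀ x y, (x, y) ∈ D.graph →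
      (Φ (Φs (γ (γ x))), γ (γ (Φ (Φs y))) + γ (ρ (γ x))) ∈ D.graph := by
    intro x y h
    obtain ⟨u, rfl, rfl⟩ := (LinearPMap.mem_graph_iff _).1 h
    obtain ⟨ζ, hζ⟩ := hdγ u
    have h1 : γ (ρ (γ u)) = d u := by rw [hρ u ζ hζ]; exact hζ
    have h2 : (Φ (Φs (Γ.toCLM u)), D ⟨_, hG.invariant u u.2⟩) ∈ D.graph :=
      D.mem_graph ⟨_, hG.invariant u u.2⟩
    have h3 := hd u
    rw [eq_sub_iff_add_eq] at h3
    rw [← h3, hΓ] at h2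
    rw [h1, add_comm]
    exact h2
  have hQ : ∀ μ : ℝ, ∃ Q : Y →L[ℂ] Y, μ ≠ 0 → IsTwistedResolvent D γ μ Q := by
    intro μ
    by_cases hμ : μ = 0
    · exact ⟨0, fun h => absurd hμ h⟩
    · obtain ⟨Q, hQ⟩ := exists_isTwistedResolvent hD_selfadjoint hD_regular hγ (norm_nonneg Γ)
        hκ hμ
      exact ⟨Q, fun _ => hQ⟩
  choose Q hQ using hQ
  have hT : IsSymm A (sandwich Φs D Φ) := hD.sandwich hΦ_adjoint
  have hTd : Dense ((sandwich Φs D Φ).domain : Set X) := by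
    refine (dense_image_domain hD_selfadjoint.1 hγd hΦ_dense).mono ?_
    rintro _ ⟨y, z, hyz, rfl⟩
    exact LinearPMap.mem_domain_of_mem_graph (mem_sandwich_graph (hcomm y z hyz))
  have hc := hT.isClosable hTd
  have hT' := hT.closure hc
  have hle := LinearPMap.le_closure (sandwich Φs D Φ)
  have hTd' : Dense ((sandwich Φs D Φ).closure.domain : Set X) := hTd.mono hle.1
  refine ⟨hc, hT'.isSelfAdjoint_and_isRegular hTd' fun c hc0 => ?_⟩
  have key : ∀ l : ℝ, 2 * ‖ρ‖ + 2 * ‖Φ ∘L Φs‖ * ‖γ‖ + 1 ≤ |l| →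
      AddSurjective (sandwich Φs D Φ).closure (((l : ℂ) * Complex.I) • (1 : X →L[ℂ] X)) := by
    intro l hl
    refine hT'.addSurjective_of_dense hc.closure_isClosed ?_ ?_
    · rintro rfl
      rw [abs_zero] at hl
      have : 0 ≤ 2 * ‖ρ‖ + 2 * ‖Φ ∘L Φs‖ * ‖γ‖ := by positivity
      linarith
    · refine (dense_range_sandwich_add hD hD_selfadjoint.1 hγ hγd hΦ_adjoint hΦ_dense hQ hcomm
        hl).mono ?_
      rintro v ⟨x, y, hxy, rfl⟩
      exact ⟨x, y, LinearPMap.le_graph_of_le hle hxy, rfl⟩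
  set C := 2 * ‖ρ‖ + 2 * ‖Φ ∘L Φs‖ * ‖γ‖ + 1 with hC
  have hC0 : 0 < C := by positivity
  rcases hc0.lt_or_gt with h | h
  · have h1 := (key (-C) (by rw [abs_neg, abs_of_pos hC0])).mul_pos hT' (by linarith)
      (div_pos_of_neg_of_neg h (neg_lt_zero.2 hC0))
    rwa [div_mul_cancel₀ _ (by linarith)] at h1
  · have h1 := (key C (abs_of_pos hC0).ge).mul_pos hT' (by linarith) (div_pos h hC0)
    rwa [div_mul_cancel₀ _ (by linarith)] at h1
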